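/- Let $H_1,H_2\in(0,1)$, $\sigma_1,\sigma_2>0$, $|\rho|\le 1$, and assume $H_1+H_2\neq 1$. Write $(x)_+^\beta=x^\beta$ for $x>0$ and $(x)_+^\beta=0$ for $x\le 0$, $(x)_-=(-x)_+$, and $f_\pm(s;t,\beta)=(t-s)_\pm^\beta-(-s)_\pm^\beta$. Let $W_1,W_2$ be independent Brownian motions on the real line, $\tilde W_1=W_1$, $\tilde W_2=\rho W_1+\sqrt{1-\rho^2}\,W_2$. Let $\mathbf Z(t)=(Z_1(t),Z_2(t))$, $t\ge 0$, be the two-dimensional fractional Brownian motion $Z_j(t)=\sigma_j\int_{\mathbb R} g_j(s;t)\,\mathrm d\tilde W_j(s)$, where either (causal) $g_j(s;t)=a_{H_j}f_+(s;t,H_j-\tfrac12)$ with $a_H=\sqrt{\Gamma(2H+1)\sin(\pi H)}\,/\,\Gamma(H+\tfrac12)$, or (well-balanced) $H_1,H_2\neq\tfrac12$ and $g_j(s;t)=a^*_{H_j}\big(f_+(s;t,H_j-\tfrac12)+f_-(s;t,H_j-\tfrac12)\big)$ with $a^*_{H_j}>0$ chosen so that $\langle Z_j(1)^2\rangle=\sigma_j^2$.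 Put $K=\dfrac{\sqrt{\Gamma(2H_1+1)\Gamma(2H_2+1)\sin(\pi H_1)\sin(\pi H_2)}}{\Gamma(H_1+H_2+1)}$, $\rho_{jj}=1$, $\eta_{jj}=0$, and let $$\rho_{12}=\rho_{21}=\frac{\rho K\cos\frac{(H_2-H_1)\pi}{2}}{\sin\frac{(H_1+H_2)\pi}{2}},\qquad \eta_{12}=-\eta_{21}=\frac{\rho K\sin\frac{(H_2-H_1)\pi}{2}}{\cos\frac{(H_1+H_2)\pi}{2}}$$ in the causal case, and $$\rho_{12}=\rho_{21}=\operatorname{sign}\big((H_1-\tfrac12)(H_2-\tfrac12)\big)\frac{\rho K}{\sin\frac{(H_1+H_2)\pi}{2}},\qquad \eta_{12}=\eta_{21}=0$$ in the well-balanced case. For $T>0$, $f\in\mathbb R$ and $j,k\in\{1,2\}$ let $$\langle S_{jk}\rangle=\frac1T\int_0^T\!\!\int_0^T e^{if(t-s)}\langle Z_j(t)Z_k(s)\rangle\,\mathrm ds\,\mathrm dt$$ be the ensemble-averaged finite-time power spectral density, and let $\tilde\omega=fT$, $\mathcal C_{jk}(\tilde\omega)=\int_0^1\cos(\tilde\omega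 x)x^{H_j+H_k}\mathrm dx$, $\mathcal S_{jk}(\tilde\omega)=\int_0^1\sin(\tilde\omega x)x^{H_j+H_k}\mathrm dx$. Then $\mathcal C_{jk}$ and $\mathcal S_{jk}$ are differentiable at $\tilde\omega$, the products $Z_j(t)Z_k(s)$ and the integrand above are integrable, and $$\langle S_{jk}\rangle=T^{H_j+H_k+1}\sigma_j\sigma_k\Big\{\rho_{jk}\Big[\tfrac{1-\cos\tilde\omega}{\tilde\omega}\mathcal S_{jk}-\Big(1-\tfrac{\sin\tilde\omega}{\tilde\omega}\Big)\mathcal C_{jk}+\tfrac{\mathrm d}{\mathrm d\tilde\omega}\mathcal S_{jk}\Big]+i\,\eta_{jk}\Big[-\tfrac{1-\cos\tilde\omega}{\tilde\omega}\mathcal C_{jk}-\Big(1-\tfrac{\sin\tilde\omega}{\tilde\omega}\Big)\mathcal S_{jk}-\tfrac{\mathrm d}{\mathrm d\tilde\omega}\mathcal C_{jk}\Big]\Big\},$$ the quotients being continued continuously to $\tilde\omega=0$. If moreover $\mathbf Z$ is jointly measurable on $[0,T]\times\Omega$, then almost every trajectory is integrable on $[0,T]$, the random variable $\frac1T\int_0^T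 e^{ift}Z_j(t)\,\mathrm dt\;\overline{\int_0^T e^{ifs}Z_k(s)\,\mathrm ds}$ is integrable, and its expected value is equal to the same expression. -/

import Mathlib

open MeasureTheory ProbabilityTheory Filter Topology
open scoped NNReal ComplexConjugate

namespace FBm2D

/-! ### Brownian motion on the real line and the Wiener integral -/

section Wiener

variable {Ω : Type*} [MeasurableSpace Ω]

/-- Brownian motion indexed by the whole real line: the two half-lines carry independent
Brownian motions. -/
structure IsTwoSidedBrownianMotion (W : ℝ → Ω → ℝ) (P : Measure Ω) : Prop where
  forward : IsBrownianReal (fun (t : ℝ≥0) ω => W (t : ℝ) ω) P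
  backward : IsBrownianReal (fun (t : ℝ≥0) ω => W (-(t : ℝ)) ω) P
  indep : IndepFun (fun ω (t : ℝ≥0) => W (t : ℝ) ω) (fun ω (t : ℝ≥0) => W (-(t : ℝ)) ω) P

/-- A real step function `∑ i, coeff i * 1_{(left i, right i]}` on the line. -/
structure StepFunction where
  n : ℕ
  left : Fin n → ℝ
  right : Fin n → ℝ
  coeff : Fin n → ℝ
  left_le_right : ∀ i, left i ≤ right i

/-- The function on `ℝ` described by the data of a step function. -/
noncomputable def StepFunction.eval (φ : StepFunction) (x : ℝ) : ℝ :=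
  ∑ i, φ.coeff i * (Set.Ioc (φ.left i) (φ.right i)).indicator (fun _ => (1 : ℝ)) x

/-- The elementary stochastic integral `∑ i, coeff i * (W (right i) - W (left i))`. -/
def StepFunction.integral (φ : StepFunction) (W : ℝ → Ω → ℝ) (ω : Ω) : ℝ :=
  ∑ i, φ.coeff i * (W (φ.right i) ω - W (φ.left i) ω)

/-- `X` is (a version of) the Wiener integral `∫ g dW` over the real line: it is the limit in
`L²(P)` of the elementary integrals of step functions that converge to `g` in `L²(ℝ)`. -/
def IsWienerIntegral (W : ℝ → Ω → ℝ) (P : Measure Ω) (g : ℝ → ℝ) (X : Ω → ℝ) : Prop :=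
  AEStronglyMeasurable X P ∧ ∃ φ : ℕ → StepFunction,
    Tendsto (fun n => eLpNorm (fun x => (φ n).eval x - g x) 2 volume) atTop (𝓝 0) ∧
    Tendsto (fun n => eLpNorm (fun ω => (φ n).integral W ω - X ω) 2 P) atTop (𝓝 0)

end Wiener

/-! ### The kernels -/

/-- `(x)_+ ^ β`, which is `0` for `x ≤ 0` whatever the exponent. -/
noncomputable def posPow (x β : ℝ) : ℝ := if 0 < x then x ^ β else 0

/-- `(x)_- ^ β`, where `(x)_- = (-x)_+`. -/
noncomputable def negPow (x β : ℝ) : ℝ := posPow (-x) β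

/-- `f_+(x; t, β) = (t - x)_+ ^ β - (-x)_+ ^ β`. -/
noncomputable def fPlus (x t β : ℝ) : ℝ := posPow (t - x) β - posPow (-x) β

/-- `f_-(x; t, β) = (t - x)_- ^ β - (-x)_- ^ β`. -/
noncomputable def fMinus (x t β : ℝ) : ℝ := negPow (t - x) β - negPow (-x) β

/-- The normalizing constant `a_H` of the causal kernel. -/
noncomputable def aCausal (H : ℝ) : ℝ :=
  √(Real.Gamma (2 * H + 1) * Real.sin (H * Real.pi)) / Real.Gamma (H + 1 / 2)

/-- The normalizing constant `a*_H` of the well-balanced kernel: the positive number with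
`a*_H ^ 2 * ∫ (f_+(s; 1, H - 1/2) + f_-(s; 1, H - 1/2)) ^ 2 ds = 1` (for `H ≠ 1/2`; at `H = 1/2`
the integrand vanishes almost everywhere and there is no such number). -/
noncomputable def aWellBalanced (H : ℝ) : ℝ :=
  (√(∫ s : ℝ, (fPlus s 1 (H - 1 / 2) + fMinus s 1 (H - 1 / 2)) ^ 2))⁻¹

/-- The two versions of two-dimensional fractional Brownian motion. -/
inductive Model where
  | causal
  | wellBalanced

/-- The normalized scalar kernel of the model, as a function of the time `t` and of the
integration variable `s`. -/
noncomputable def kernel : Model → ℝ → ℝ → ℝ → ℝ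
  | .causal, H, t, s => aCausal H * fPlus s t (H - 1 / 2)
  | .wellBalanced, H, t, s =>
      aWellBalanced H * (fPlus s t (H - 1 / 2) + fMinus s t (H - 1 / 2))

/-- The matrix that correlates the two noises. -/
noncomputable def mixing (ρ : ℝ) : Matrix (Fin 2) (Fin 2) ℝ := !![1, 0; ρ, √(1 - ρ ^ 2)]

/-- The `2 × 2` matrix kernel `diag(σ_j g_j(t, s)) * mixing ρ`. -/
noncomputable def matrixKernel (m : Model) (H σ : Fin 2 → ℝ) (ρ t s : ℝ) :
    Matrix (Fin 2) (Fin 2) ℝ :=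
  Matrix.diagonal (fun j => σ j * kernel m (H j) t s) * mixing ρ

section Trajectory

variable {Ω : Type*} [MeasurableSpace Ω]

/-- `Z = (Z 0, Z 1)`, restricted to times `t ≥ 0`, is a two-dimensional fractional Brownian motion
(of the given model): there are independent Brownian motions `W 0`, `W 1` on the real line such
that for every `t ≥ 0`, almost surely, `Z(t) = ∫ matrixKernel(t, s) dW(s)`. -/
def IsFBm2D (m : Model) (H σ : Fin 2 → ℝ) (ρ : ℝ) (Z : Fin 2 → ℝ → Ω → ℝ)
    (P : Measure Ω) : Prop :=
  ∃ W : Fin 2 → ℝ → Ω → ℝ,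
    (∀ l, IsTwoSidedBrownianMotion (W l) P) ∧
    IndepFun (fun ω (t : ℝ) => W 0 t ω) (fun ω (t : ℝ) => W 1 t ω) P ∧
    ∀ t : ℝ, 0 ≤ t → ∀ j, ∃ Y : Fin 2 → Ω → ℝ,
      (∀ l, IsWienerIntegral (W l) P (fun s => matrixKernel m H σ ρ t s j l) (Y l)) ∧
      Z j t =ᵐ[P] fun ω => ∑ l, Y l ω

/-! ### Power spectral densities -/

/-- The `(j, k)` entry of the power spectral density of one trajectory on `[0, T]`. -/
noncomputable def psd (Z : Fin 2 → ℝ → Ω → ℝ) (j k : Fin 2) (f T : ℝ) (ω : Ω) : ℂ :=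
  (1 / (T : ℂ)) *
    ((∫ t in (0 : ℝ)..T, Complex.exp (Complex.I * f * t) * (Z j t ω : ℂ)) *
      conj (∫ s in (0 : ℝ)..T, Complex.exp (Complex.I * f * s) * (Z k s ω : ℂ)))

/-- The integrand `e^{i f (t - s)} ⟨Z_j(t) Z_k(s)⟩` of the ensemble-averaged density. -/
noncomputable def psdIntegrand (Z : Fin 2 → ℝ → Ω → ℝ) (P : Measure Ω) (j k : Fin 2)
    (f t s : ℝ) : ℂ :=
  Complex.exp (Complex.I * f * (t - s)) * ((∫ ω, Z j t ω * Z k s ω ∂P : ℝ) : ℂ)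

/-- The `(j, k)` entry of the ensemble-averaged power spectral density over `[0, T]`. -/
noncomputable def ensemblePSD (Z : Fin 2 → ℝ → Ω → ℝ) (P : Measure Ω) (j k : Fin 2)
    (f T : ℝ) : ℂ :=
  (1 / (T : ℂ)) * ∫ t in (0 : ℝ)..T, ∫ s in (0 : ℝ)..T, psdIntegrand Z P j k f t s

end Trajectory

/-! ### The parameters and the functions in the formula -/

/-- The factor `√(Γ(2H₁+1) Γ(2H₂+1) sin(H₁π) sin(H₂π)) / Γ(H₁+H₂+1)`. -/
noncomputable def gammaFactor (H : Fin 2 → ℝ) : ℝ :=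
  √(Real.Gamma (2 * H 0 + 1) * Real.Gamma (2 * H 1 + 1) *
      Real.sin (H 0 * Real.pi) * Real.sin (H 1 * Real.pi)) / Real.Gamma (H 0 + H 1 + 1)

/-- The cross-correlation parameters `ρ_jk`. -/
noncomputable def rhoParam (m : Model) (H : Fin 2 → ℝ) (ρ : ℝ) (j k : Fin 2) : ℝ :=
  if j = k then 1 else
    match m with
    | .causal =>
        ρ * gammaFactor H / Real.sin ((H 0 + H 1) / 2 * Real.pi) *
          Real.cos ((H 1 - H 0) * Real.pi / 2)
    | .wellBalanced =>
        Real.sign ((H 0 - 1 / 2) * (H 1 - 1 / 2)) *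
          (ρ * gammaFactor H / Real.sin ((H 0 + H 1) / 2 * Real.pi))

/-- The asymmetry parameters `η_jk`. -/
noncomputable def etaParam (m : Model) (H : Fin 2 → ℝ) (ρ : ℝ) (j k : Fin 2) : ℝ :=
  if j = k then 0 else
    match m with
    | .causal =>
        ρ * gammaFactor H / Real.cos ((H 0 + H 1) / 2 * Real.pi) *
          Real.sin ((H k - H j) * Real.pi / 2)
    | .wellBalanced => 0

/-- `𝒞(w) = ∫_0^1 cos(w x) x^h dx`. -/
noncomputable def cosMoment (h w : ℝ) : ℝ := ∫ x in (0 : ℝ)..1, Real.cos (w * x) * x ^ h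

/-- `𝒮(w) = ∫_0^1 sin(w x) x^h dx`. -/
noncomputable def sinMoment (h w : ℝ) : ℝ := ∫ x in (0 : ℝ)..1, Real.sin (w * x) * x ^ h

/-- The bracket that multiplies `ρ_jk`; `Real.sinc w` is `sin w / w`, continued by `1` at `0`. -/
noncomputable def rhoBracket (h w : ℝ) : ℝ :=
  (1 - Real.cos w) / w * sinMoment h w - (1 - Real.sinc w) * cosMoment h w + deriv (sinMoment h) w

/-- The bracket that multiplies `i η_jk`. -/
noncomputable def etaBracket (h w : ℝ) : ℝ :=
  -((1 - Real.cos w) / w * cosMoment h w) - (1 - Real.sinc w) * sinMoment h w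
    - deriv (cosMoment h) w

/-- The closed form of the ensemble-averaged power spectral density, at `w = f * T`. -/
noncomputable def closedForm (m : Model) (H σ : Fin 2 → ℝ) (ρ : ℝ) (j k : Fin 2) (w T : ℝ) : ℂ :=
  ((T ^ (H j + H k + 1) * σ j * σ k : ℝ) : ℂ) *
    (((rhoParam m H ρ j k * rhoBracket (H j + H k) w : ℝ) : ℂ) +
      Complex.I * ((etaParam m H ρ j k * etaBracket (H j + H k) w : ℝ) : ℂ))

end FBm2D

open FBm2D

namespace FBm2D

/-! ### The Beta integral and incomplete Beta integrals on a half-line -/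

/-! The formula depends only on the covariance. By the Wiener isometry
(`IsWienerIntegral.integral_mul`), the independence of the two noises and `mixing_mul_transpose`,
the covariance of `Z_j(t)` and `Z_k(u)` is `σ_j σ_k`, times `1` or `ρ`, times the `L²` inner product
of two scalar kernels. Two computations remain.

Inner products of kernels. Put `a = H_j - 1/2`, `b = H_k - 1/2`, `h = a + b + 1`. Expanding the
increments gives products of powers that are in general not integrable at infinity. Cut off to `[-R,
R]`, each is a divergent part, plus a finite part, plus `o(1)`. The divergent part is a function of
`t` plus a function of `u`, so it cancels in the second difference; multiples of one-sided powers
with exponent `h` survive (`tendsto_integral_powIncrement_mul`). Their constants are Beta integrals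
continued beyond the range of convergence: `incBeta_recurrence` lowers an exponent until the
integral converges, and `finitePartConst_eq` applies the reflection formula. The step divides by `a
+ b`, which is where `H_1 + H_2 ≠ 1` enters; on the diagonal `a + b = 0` means `H = 1/2`, where the
causal kernel is an indicator. The outcome is `fbmCov` with parameters `ρ_jk`, `η_jk`
(`integral_kernel_mul`).

Fourier integral. Self-similarity reduces `[0, T]` to `[0, 1]`. The covariance is a function of `t`,
plus one of `s`, plus one of `t - s`. The first two give products of single integrals; the third
gives an integral against the tent `1 - z` (`integral_integral_sub_eq`), whose extra factor `z`
amounts to a derivative in the frequency. For trajectories, bounded second moments on `[0, T]`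
justify Fubini. -/

lemma intervalIntegrable_rpow_mul_one_sub_rpow {a b : ℝ} (ha : -1 < a) (hb : -1 < b) :
    IntervalIntegrable (fun x : ℝ => x ^ a * (1 - x) ^ b) volume 0 1 := by
  have h := Complex.betaIntegral_convergent (u := ((a + 1 : ℝ) : ℂ)) (v := ((b + 1 : ℝ) : ℂ))
    (by rw [Complex.ofReal_re]; linarith) (by rw [Complex.ofReal_re]; linarith)
  rw [intervalIntegrable_iff_integrableOn_Ioc_of_le zero_le_one] at h ⊢
  refine (integrableOn_congr_fun ?_ measurableSet_Ioc).mp h.re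
  intro x hx
  have h0 : (0 : ℝ) ≤ 1 - x := by linarith [hx.2]
  have e : ((x : ℂ) ^ (((a + 1 : ℝ) : ℂ) - 1) * (1 - (x : ℂ)) ^ (((b + 1 : ℝ) : ℂ) - 1)) =
      ((x ^ a * (1 - x) ^ b : ℝ) : ℂ) := by
    rw [Complex.ofReal_mul, Complex.ofReal_cpow hx.1.le, Complex.ofReal_cpow h0]
    push_cast
    ring_nf
  simp only [e, RCLike.re_eq_complex_re, Complex.ofReal_re]

lemma integral_rpow_mul_one_sub_rpow {a b : ℝ} (ha : -1 < a) (hb : -1 < b) :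
    ∫ x in (0 : ℝ)..1, x ^ a * (1 - x) ^ b = beta (a + 1) (b + 1) := by
  rw [beta_eq_betaIntegralReal _ _ (by linarith) (by linarith), Complex.betaIntegral]
  have : ∫ x in (0 : ℝ)..1, (x : ℂ) ^ (((a + 1 : ℝ) : ℂ) - 1) *
      (1 - (x : ℂ)) ^ (((b + 1 : ℝ) : ℂ) - 1) =
      ∫ x in (0 : ℝ)..1, ((x ^ a * (1 - x) ^ b : ℝ) : ℂ) := by
    refine intervalIntegral.integral_congr_ae (Eventually.of_forall fun x hx => ?_)
    rw [Set.uIoc_of_le zero_le_one] at hx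
    have h0 : (0 : ℝ) ≤ 1 - x := by linarith [hx.2]
    rw [Complex.ofReal_mul, Complex.ofReal_cpow hx.1.le, Complex.ofReal_cpow h0]
    push_cast
    ring_nf
  rw [this, intervalIntegral.integral_ofReal, Complex.ofReal_re]

/-- `∫_0^R (x + v)^a v^b dv`. -/
noncomputable def incBeta (a b x R : ℝ) : ℝ := ∫ v in (0 : ℝ)..R, (x + v) ^ a * v ^ b

lemma intervalIntegrable_add_rpow_mul_rpow {a b x R : ℝ} (hx : 0 < x) (hb : -1 < b)
    (hR : 0 ≤ R) : IntervalIntegrable (fun v : ℝ => (x + v) ^ a * v ^ b) volume 0 R := by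
  refine (intervalIntegral.intervalIntegrable_rpow' hb).continuousOn_mul ?_
  intro v hv
  rw [Set.uIcc_of_le hR] at hv
  have : x + v ≠ 0 := by linarith [hv.1]
  exact (ContinuousAt.rpow_const (by fun_prop) (Or.inl this)).continuousWithinAt

/-- Integrate the derivative of `(x + v) ^ a * v ^ (b + 1)` and write `v = (x + v) - x`. The
exponent `a` is traded for `a - 1`, which improves the decay at infinity. -/
lemma incBeta_recurrence {a b x R : ℝ} (hx : 0 < x) (hb : -1 < b) (hR : 0 ≤ R) :
    (a + b + 1) * incBeta a b x R =
      (x + R) ^ a * R ^ (b + 1) + a * x * incBeta (a - 1) b x R := by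
  have i1 := intervalIntegrable_add_rpow_mul_rpow (a := a) hx hb hR
  have i2 := intervalIntegrable_add_rpow_mul_rpow (a := a - 1) hx hb hR
  have key : ∫ v in (0 : ℝ)..R, ((a + b + 1) * ((x + v) ^ a * v ^ b) -
      a * x * ((x + v) ^ (a - 1) * v ^ b)) =
      (x + R) ^ a * R ^ (b + 1) - (x + 0) ^ a * 0 ^ (b + 1) := by
    refine intervalIntegral.integral_eq_sub_of_hasDerivAt_of_le
      (f := fun v => (x + v) ^ a * v ^ (b + 1)) hR ?_ ?_ ((i1.const_mul _).sub (i2.const_mul _))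
    · intro v hv
      have : x + v ≠ 0 := by linarith [hv.1]
      refine (ContinuousAt.mul (ContinuousAt.rpow_const (by fun_prop) (Or.inl this))
        (ContinuousAt.rpow_const (by fun_prop) (Or.inr (by linarith)))).continuousWithinAt
    · intro v hv
      have h1 : 0 < x + v := by linarith [hv.1]
      have d1 : HasDerivAt (fun v => (x + v) ^ a) (1 * a * (x + v) ^ (a - 1)) v :=
        ((hasDerivAt_id v).const_add x).rpow_const (Or.inl h1.ne')
      have d2 : HasDerivAt (fun v : ℝ => v ^ (b + 1)) ((b + 1) * v ^ (b + 1 - 1)) v :=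
        Real.hasDerivAt_rpow_const (Or.inl hv.1.ne')
      refine (d1.mul d2).congr_deriv ?_
      have e1 : (x + v) ^ a = (x + v) ^ (a - 1) * (x + v) := by
        rw [← Real.rpow_add_one h1.ne']; ring_nf
      have e2 : v ^ (b + 1) = v ^ b * v := Real.rpow_add_one hv.1.ne' b
      rw [add_sub_cancel_right, e2, e1]
      ring
  rw [intervalIntegral.integral_sub (i1.const_mul _) (i2.const_mul _),
    intervalIntegral.integral_const_mul, intervalIntegral.integral_const_mul,
    Real.zero_rpow (by linarith)] at key
  unfold incBeta
  linarith

/-- Substitute `y = v / (x + v)`. The new exponent `-a - b - 2` exceeds `-1` exactly when `a + b + 1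
< 0`, so the right side stays bounded as the upper limit tends to `1`. -/
lemma incBeta_eq_rpow_mul_integral {a b x R : ℝ} (hx : 0 < x) (hb : -1 < b) (hR : 0 ≤ R)
    (hab : a + b + 1 < 0) :
    incBeta a b x R =
      x ^ (a + b + 1) * ∫ y in (0 : ℝ)..R / (x + R), y ^ b * (1 - y) ^ (-a - b - 2) := by
  set c : ℝ := -a - b - 2 with hc
  have hc1 : -1 < c := by linarith
  have hpos : ∀ v : ℝ, 0 ≤ v → 0 < x + v := fun v hv => by linarith
  have himg : ∀ v ∈ Set.Icc 0 R, v / (x + v) ∈ Set.Ico (0 : ℝ) 1 := fun v hv =>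
    ⟨div_nonneg hv.1 (hpos v hv.1).le, by rw [div_lt_one (hpos v hv.1)]; linarith⟩
  have hid : ∀ v ∈ Set.Ioc 0 R, (v / (x + v)) ^ b * (1 - v / (x + v)) ^ c * (x / (x + v) ^ 2) =
      x ^ (-(a + b + 1)) * ((x + v) ^ a * v ^ b) := by
    intro v hv
    have h1 := hpos v hv.1.le
    have e : 1 - v / (x + v) = x / (x + v) := by field_simp; ring
    rw [e, Real.div_rpow hv.1.le h1.le, Real.div_rpow hx.le h1.le]
    have e2 : (x + v) ^ a = (x + v) ^ (-c) * (x + v) ^ (-b) * (x + v) ^ (-2 : ℝ) := by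
      rw [← Real.rpow_add h1, ← Real.rpow_add h1]; congr 1; rw [hc]; ring
    have e3 : x ^ (-(a + b + 1)) = x ^ c * x := by
      rw [← Real.rpow_add_one hx.ne']; congr 1; rw [hc]; ring
    rw [e2, e3, Real.rpow_neg h1.le, Real.rpow_neg h1.le, Real.rpow_neg h1.le, Real.rpow_two]
    field_simp
  have i0 := intervalIntegrable_add_rpow_mul_rpow (a := a) hx hb hR
  -- This form of the substitution rule asks for continuity of `g` only over the open interval; `y ^
  -- b` may blow up at `0`.
  have hsub := intervalIntegral.integral_comp_mul_deriv''' (a := 0) (b := R)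
    (f := fun v => v / (x + v)) (f' := fun v => x / (x + v) ^ 2)
    (g := fun y => y ^ b * (1 - y) ^ c) ?_ ?_ ?_ ?_ ?_
  · simp only [Function.comp_def, zero_div] at hsub
    rw [← hsub]
    have : ∫ v in (0 : ℝ)..R, (v / (x + v)) ^ b * (1 - v / (x + v)) ^ c * (x / (x + v) ^ 2) =
        ∫ v in (0 : ℝ)..R, x ^ (-(a + b + 1)) * ((x + v) ^ a * v ^ b) := by
      refine intervalIntegral.integral_congr_ae (Eventually.of_forall fun v hv => ?_)
      rw [Set.uIoc_of_le hR] at hv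
      exact hid v hv
    rw [this, intervalIntegral.integral_const_mul, ← mul_assoc, ← Real.rpow_add hx,
      add_neg_cancel, Real.rpow_zero, one_mul, incBeta]
  · intro v hv
    rw [Set.uIcc_of_le hR] at hv
    exact (ContinuousAt.div (by fun_prop) (by fun_prop) (hpos v hv.1).ne').continuousWithinAt
  · intro v hv
    rw [min_eq_left hR, max_eq_right hR] at hv
    have h1 := hpos v hv.1.le
    refine HasDerivAt.hasDerivWithinAt ?_
    refine ((hasDerivAt_id v).div ((hasDerivAt_id v).const_add x) h1.ne').congr_deriv ?_
    simp
  · rintro _ ⟨v, hv, rfl⟩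
    rw [min_eq_left hR, max_eq_right hR] at hv
    have h2 := (himg v ⟨hv.1.le, hv.2.le⟩).2
    have h3 : 0 < v / (x + v) := div_pos hv.1 (hpos v hv.1.le)
    simp only
    generalize v / (x + v) = y at h2 h3
    exact (ContinuousAt.mul (ContinuousAt.rpow_const continuousAt_id (Or.inl h3.ne'))
      (ContinuousAt.rpow_const (by fun_prop)
        (Or.inl (sub_pos.mpr h2).ne'))).continuousWithinAt
  · have := (intervalIntegrable_iff_integrableOn_Icc_of_le zero_le_one).mp
      (intervalIntegrable_rpow_mul_one_sub_rpow hb hc1)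
    refine this.mono_set ?_
    rintro _ ⟨v, hv, rfl⟩
    rw [Set.uIcc_of_le hR] at hv
    exact ⟨(himg v hv).1, (himg v hv).2.le⟩
  · rw [Set.uIcc_of_le hR, integrableOn_Icc_iff_integrableOn_Ioc]
    refine (integrableOn_congr_fun (fun v hv => (hid v hv).symm) measurableSet_Ioc).mp ?_
    exact ((intervalIntegrable_iff_integrableOn_Ioc_of_le hR).mp i0).const_mul _

lemma tendsto_incBeta {a b x : ℝ} (hx : 0 < x) (hb : -1 < b) (hab : a + b + 1 < 0) :
    Tendsto (incBeta a b x) atTop (𝓝 (x ^ (a + b + 1) * beta (b + 1) (-a - b - 1))) := by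
  have hc1 : -1 < -a - b - 2 := by linarith
  have hint := intervalIntegrable_rpow_mul_one_sub_rpow hb hc1
  have hlim : Tendsto (fun R : ℝ => R / (x + R)) atTop (𝓝[Set.Icc 0 1] 1) := by
    refine tendsto_nhdsWithin_iff.mpr ⟨?_, ?_⟩
    · have : Tendsto (fun R : ℝ => 1 - x * (x + R)⁻¹) atTop (𝓝 (1 - x * 0)) :=
        (tendsto_const_nhds.sub ((tendsto_inv_atTop_zero.comp
          (tendsto_atTop_add_const_left _ _ tendsto_id)).const_mul x))
      rw [mul_zero, sub_zero] at this
      refine this.congr' ?_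
      filter_upwards [eventually_gt_atTop 0] with R hR
      have : x + R ≠ 0 := by linarith
      field_simp
      ring
    · filter_upwards [eventually_gt_atTop 0] with R hR
      exact ⟨by positivity, by rw [div_le_one (by linarith)]; linarith⟩
  have hcont : ContinuousOn (fun z => ∫ y in (0 : ℝ)..z, y ^ b * (1 - y) ^ (-a - b - 2))
      (Set.Icc 0 1) := by
    have := intervalIntegral.continuousOn_primitive_interval (μ := volume) (a := 0) (b := 1)
      (f := fun y : ℝ => y ^ b * (1 - y) ^ (-a - b - 2)) (by
        rw [Set.uIcc_of_le zero_le_one]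
        exact (intervalIntegrable_iff_integrableOn_Icc_of_le zero_le_one).mp hint)
    rwa [Set.uIcc_of_le zero_le_one] at this
  have h1 := ((hcont 1 (by simp)).tendsto.comp hlim).const_mul (x ^ (a + b + 1))
  rw [integral_rpow_mul_one_sub_rpow hb hc1] at h1
  have e : -a - b - 2 + 1 = -a - b - 1 := by ring
  rw [e] at h1
  refine h1.congr' ?_
  filter_upwards [eventually_ge_atTop 0] with R hR
  rw [incBeta_eq_rpow_mul_integral hx hb hR hab]
  rfl

/-! ### Asymptotics -/

/-- Factor out `R ^ (p + q)` and expand `(1 + a y) ^ p (1 + b y) ^ q` to first order at `y = 1 / R`.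
The remainder is `O(R ^ (p + q - 2))`, which vanishes because `p + q < 2`. -/
lemma tendsto_add_rpow_mul_add_rpow_sub {p q : ℝ} (a b : ℝ) (hpq : p + q < 2) :
    Tendsto (fun R : ℝ => (R + a) ^ p * (R + b) ^ q - R ^ (p + q) -
      (p * a + q * b) * R ^ (p + q - 1)) atTop (𝓝 0) := by
  set g : ℝ → ℝ := fun y => (1 + a * y) ^ p * (1 + b * y) ^ q with hg
  have hpa : ∀ c r : ℝ, AnalyticAt ℝ (fun y : ℝ => (1 + c * y) ^ r) 0 := fun c r =>
    (ContDiffAt.rpow_const_of_ne (by fun_prop) (by simp)).analyticAt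
  have hga : AnalyticAt ℝ g 0 := (hpa a p).mul (hpa b q)
  have hd : ∀ c r : ℝ, HasDerivAt (fun y : ℝ => (1 + c * y) ^ r) (r * c) 0 := by
    intro c r
    have := (((hasDerivAt_id (0 : ℝ)).const_mul c).const_add 1).rpow_const (p := r)
      (Or.inl (by simp))
    exact this.congr_deriv (by simp [mul_comm])
  have hgd : deriv g 0 = p * a + q * b := by
    refine ((hd a p).mul (hd b q)).deriv.trans ?_
    simp
  obtain ⟨s, hs⟩ := hga
  have hO := hs.isBigO_sub_partialSum_pow 2
  have hpart : ∀ y, s.partialSum 2 y = 1 + (p * a + q * b) * y := by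
    intro y
    have h1 : s 1 (fun _ => y) = y * s 1 (fun _ => 1) := by
      simp
    have h2 := hs.deriv
    rw [hgd] at h2
    have h3 : s 0 (fun _ => y) = g 0 := by
      rw [← hs.coeff_zero (fun _ => y)]
    rw [FormalMultilinearSeries.partialSum, Finset.sum_range_succ, Finset.sum_range_one, h1, h3,
      ← h2]
    simp [hg, mul_comm]
  simp only [hpart, zero_add] at hO
  have hinv : Tendsto (fun R : ℝ => R⁻¹) atTop (𝓝 0) := tendsto_inv_atTop_zero
  have hO2 := (Asymptotics.isBigO_refl (fun R : ℝ => R ^ (p + q)) atTop).mul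
    (hO.comp_tendsto hinv)
  have hz : Tendsto (fun R : ℝ => R ^ (p + q) * ‖R⁻¹‖ ^ 2) atTop (𝓝 0) := by
    refine (tendsto_rpow_neg_atTop (y := 2 - (p + q)) (by linarith)).congr' ?_
    filter_upwards [eventually_gt_atTop 0] with R hR
    rw [Real.norm_eq_abs, abs_of_pos (inv_pos.mpr hR), inv_pow, ← Real.rpow_two,
      ← Real.rpow_neg hR.le, ← Real.rpow_add hR]
    congr 1; ring
  refine (hO2.trans_tendsto hz).congr' ?_
  filter_upwards [eventually_gt_atTop 0, eventually_gt_atTop (-a), eventually_gt_atTop (-b)]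
    with R hR ha hb
  have e : ∀ c, R + c = R * (1 + c * R⁻¹) := fun c => by field_simp
  have e' : ∀ c, -c < R → 0 ≤ 1 + c * R⁻¹ := fun c hc => by
    have : 0 < R * (1 + c * R⁻¹) := by rw [← e]; linarith
    exact (pos_of_mul_pos_right this hR.le).le
  simp only [Function.comp_apply, hg]
  rw [e a, e b, Real.mul_rpow hR.le (e' a ha), Real.mul_rpow hR.le (e' b hb), Real.rpow_add hR,
    Real.rpow_sub hR, Real.rpow_add hR, Real.rpow_one]
  ring

/-! ### Truncated products of one-sided powers -/

/-- The constant in the finite part of `∫_0^∞ (x + v)^a v^b dv`. -/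
noncomputable def finitePartConst (a b : ℝ) : ℝ :=
  a * (a - 1) / ((a + b + 1) * (a + b)) * beta (b + 1) (1 - a - b)

/-- Two applications of the recurrence reach the exponent `a - 2`, where the integral converges
since `a + b < 1`. The boundary terms carry the divergence. For `a + b = 0` a logarithm could
appear, hence `h1`. The shift `u` in the upper limit comes from the later substitution `v = u - s`.
-/
lemma tendsto_incBeta_sub {a b x : ℝ} (hx : 0 ≤ x) (hb : -1 < b) (h0 : 0 < a + b + 1)
    (h1 : a + b ≠ 0) (h2 : a + b < 1) (u : ℝ) :
    Tendsto (fun R : ℝ => incBeta a b x (R + u) - R ^ (a + b + 1) / (a + b + 1) -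
      R ^ (a + b) * (u + a * x / (a + b))) atTop
      (𝓝 (finitePartConst a b * x ^ (a + b + 1))) := by
  rcases hx.eq_or_lt with rfl | hx
  · have hlim := (tendsto_add_rpow_mul_add_rpow_sub (p := a + b + 1) (q := 0) u 0
      (by linarith)).div_const (a + b + 1)
    rw [zero_div] at hlim
    simp only [Real.zero_rpow h0.ne', mul_zero]
    refine hlim.congr' ?_
    filter_upwards [eventually_gt_atTop 0, eventually_gt_atTop (-u)] with R hR hRu
    have hRu' : 0 ≤ R + u := by linarith
    have : incBeta a b 0 (R + u) = (R + u) ^ (a + b + 1) / (a + b + 1) := by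
      have : incBeta a b 0 (R + u) = ∫ v in (0 : ℝ)..R + u, v ^ (a + b) := by
        refine intervalIntegral.integral_congr_ae (Eventually.of_forall fun v hv => ?_)
        rw [Set.uIoc_of_le hRu'] at hv
        simp only [zero_add]
        rw [Real.rpow_add hv.1]
      rw [this, integral_rpow (Or.inl (by linarith)), Real.zero_rpow h0.ne', sub_zero]
    rw [this]
    simp only [add_zero, Real.rpow_zero, mul_one, mul_zero, zero_div]
    rw [add_sub_cancel_right]
    field_simp
  · have l1 := tendsto_add_rpow_mul_add_rpow_sub (p := a) (q := b + 1) (x + u) u (by linarith)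
    have l2 := tendsto_add_rpow_mul_add_rpow_sub (p := a - 1) (q := b + 1) (x + u) u
      (by linarith)
    -- Because `a + b < 1`, the first-order term of `l2` tends to `0`; the second boundary term
    -- contributes only `R ^ (a + b)`.
    have l2' : Tendsto (fun R : ℝ => ((a - 1) * (x + u) + (b + 1) * u) *
        R ^ (a - 1 + (b + 1) - 1)) atTop (𝓝 0) := by
      have : Tendsto (fun R : ℝ => R ^ (-(1 - a - b))) atTop (𝓝 0) :=
        tendsto_rpow_neg_atTop (by linarith)
      have := this.const_mul ((a - 1) * (x + u) + (b + 1) * u)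
      rw [mul_zero] at this
      refine this.congr fun R => ?_
      ring_nf
    have l3 := (tendsto_incBeta (a := a - 1 - 1) (b := b) hx hb (by linarith)).comp
      (tendsto_atTop_add_const_right atTop u tendsto_id)
    have hsum := (l1.add (((l2.add l2').add (l3.const_mul ((a - 1) * x))).const_mul
      (a * x / (a + b)))).div_const (a + b + 1)
    have hval : (0 + a * x / (a + b) * (0 + 0 + (a - 1) * x * (x ^ (a - 1 - 1 + b + 1) *
        beta (b + 1) (-(a - 1 - 1) - b - 1)))) / (a + b + 1) =
        finitePartConst a b * x ^ (a + b + 1) := by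
      have e1 : x ^ (a + b + 1) = x ^ (a - 1 - 1 + b + 1) * x * x := by
        rw [← Real.rpow_add_one hx.ne', ← Real.rpow_add_one hx.ne']; ring_nf
      have e2 : -(a - 1 - 1) - b - 1 = 1 - a - b := by ring
      rw [e1, e2, finitePartConst]
      field_simp
      ring
    rw [hval] at hsum
    refine hsum.congr' ?_
    filter_upwards [eventually_gt_atTop 0, eventually_gt_atTop (-u)] with R hR hRu
    have hRu' : 0 ≤ R + u := by linarith
    have r1 := incBeta_recurrence (a := a) hx hb hRu'
    have r2 := incBeta_recurrence (a := a - 1) hx hb hRu'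
    have e0 : R ^ (a + (b + 1)) = R ^ (a + b) * R := by
      rw [← Real.rpow_add_one hR.ne']; ring_nf
    have e1 : R ^ (a + b + 1) = R ^ (a + b) * R := Real.rpow_add_one hR.ne' _
    have e2 : R ^ (a + (b + 1) - 1) = R ^ (a + b) := by ring_nf
    have e3 : R ^ (a - 1 + (b + 1)) = R ^ (a + b) := by ring_nf
    have e4 : R + (x + u) = x + (R + u) := by ring
    have e5 : a - 1 + b + 1 = a + b := by ring
    rw [e5] at r2
    simp only [Function.comp_apply, id_eq]
    rw [e0, e1, e2, e3, e4]
    have q2 : incBeta (a - 1) b x (R + u) = ((x + (R + u)) ^ (a - 1) * (R + u) ^ (b + 1) +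
        (a - 1) * x * incBeta (a - 1 - 1) b x (R + u)) / (a + b) := by
      rw [eq_div_iff h1]; linarith
    have q1 : incBeta a b x (R + u) = ((x + (R + u)) ^ a * (R + u) ^ (b + 1) +
        a * x * incBeta (a - 1) b x (R + u)) / (a + b + 1) := by
      rw [eq_div_iff h0.ne']; linarith
    rw [q1, q2]
    field_simp
    ring

lemma measurable_posPow (c : ℝ) : Measurable fun y => posPow y c :=
  Measurable.ite measurableSet_Ioi (by fun_prop) measurable_const

lemma posPow_of_pos {y : ℝ} (hy : 0 < y) (c : ℝ) : posPow y c = y ^ c := if_pos hy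

lemma posPow_of_nonpos {y : ℝ} (hy : y ≤ 0) (c : ℝ) : posPow y c = 0 := if_neg hy.not_gt

lemma posPow_sq (y c : ℝ) : posPow y c ^ 2 = posPow y (2 * c) := by
  unfold posPow
  split_ifs with h
  · rw [← Real.rpow_natCast, ← Real.rpow_mul h.le, mul_comm]; norm_num
  · norm_num

lemma intervalIntegrable_posPow {c : ℝ} (hc : -1 < c) (x y : ℝ) :
    IntervalIntegrable (fun s => posPow s c) volume x y := by
  have h := intervalIntegral.intervalIntegrable_rpow' (a := x) (b := y) hc
  rw [intervalIntegrable_iff] at h ⊢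
  refine (h.indicator (measurableSet_Ioi (a := (0 : ℝ)))).congr (Eventually.of_forall fun s => ?_)
  simp only [Set.indicator_apply, Set.mem_Ioi, posPow]

lemma memLp_posPow_sub {c : ℝ} (hc : -1 / 2 < c) (t x y : ℝ) :
    MemLp (fun s => posPow (t - s) c) 2 (volume.restrict (Set.uIoc x y)) := by
  have hm : Measurable fun s => posPow (t - s) c :=
    (measurable_posPow c).comp (measurable_const.sub measurable_id)
  rw [memLp_two_iff_integrable_sq hm.aestronglyMeasurable]
  simp only [posPow_sq]
  have h := (intervalIntegrable_posPow (c := 2 * c) (by linarith) (t - x) (t - y)).comp_sub_left t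
  simp only [sub_sub_cancel] at h
  exact intervalIntegrable_iff.mp h

lemma memLp_negPow_sub {c : ℝ} (hc : -1 / 2 < c) (t x y : ℝ) :
    MemLp (fun s => negPow (t - s) c) 2 (volume.restrict (Set.uIoc x y)) := by
  have hm : Measurable fun s => negPow (t - s) c :=
    (measurable_posPow c).comp (measurable_const.sub measurable_id).neg
  rw [memLp_two_iff_integrable_sq hm.aestronglyMeasurable]
  simp only [negPow, posPow_sq]
  have h := (intervalIntegrable_posPow (c := 2 * c) (by linarith) (x - t) (y - t)).comp_sub_right t
  simp only [sub_add_cancel] at h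
  simp only [neg_sub]
  exact intervalIntegrable_iff.mp h

lemma intervalIntegrable_mul_of_memLp {f g : ℝ → ℝ} {x y : ℝ}
    (hf : MemLp f 2 (volume.restrict (Set.uIoc x y)))
    (hg : MemLp g 2 (volume.restrict (Set.uIoc x y))) :
    IntervalIntegrable (fun s => f s * g s) volume x y :=
  intervalIntegrable_iff.mpr (hf.integrable_mul hg)

lemma integral_posPow_mul_posPow {a b t u R : ℝ} (ha : -1 / 2 < a) (hb : -1 / 2 < b)
    (hut : u ≤ t) (hu : |u| ≤ R) :
    ∫ s in -R..R, posPow (t - s) a * posPow (u - s) b = incBeta a b (t - u) (R + u) := by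
  have hu1 := (abs_le.mp hu).1
  have hu2 := (abs_le.mp hu).2
  rw [← intervalIntegral.integral_add_adjacent_intervals (b := u)
    (intervalIntegrable_mul_of_memLp (memLp_posPow_sub ha t _ _) (memLp_posPow_sub hb u _ _))
    (intervalIntegrable_mul_of_memLp (memLp_posPow_sub ha t _ _) (memLp_posPow_sub hb u _ _))]
  have h2 : ∫ s in u..R, posPow (t - s) a * posPow (u - s) b = 0 := by
    refine intervalIntegral.integral_zero_ae (Eventually.of_forall fun s hs => ?_)
    rw [Set.uIoc_of_le hu2] at hs
    rw [posPow_of_nonpos (y := u - s) (by linarith [hs.1]), mul_zero]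
  have h1 := intervalIntegral.integral_comp_sub_left (a := 0) (b := R + u)
    (fun s => posPow (t - s) a * posPow (u - s) b) u
  rw [sub_zero, show u - (R + u) = -R by ring] at h1
  rw [h2, add_zero, ← h1, incBeta]
  refine intervalIntegral.integral_congr_ae (Eventually.of_forall fun v hv => ?_)
  rw [Set.uIoc_of_le (by linarith)] at hv
  rw [show t - (u - v) = t - u + v by ring, show u - (u - v) = v by ring,
    posPow_of_pos (by linarith [hv.1]), posPow_of_pos hv.1]

/-- The two supports meet only in the interval from `u` to `t`, so nothing diverges: once `R` is
large enough the integral is a complete Beta integral, rescaled by `t - u`. -/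
lemma integral_posPow_mul_negPow {a b t u R : ℝ} (ha : -1 / 2 < a) (hb : -1 / 2 < b)
    (ht : |t| ≤ R) (hu : |u| ≤ R) :
    ∫ s in -R..R, posPow (t - s) a * negPow (u - s) b =
      beta (a + 1) (b + 1) * posPow (t - u) (a + b + 1) := by
  have hu1 := (abs_le.mp hu).1
  have ht2 := (abs_le.mp ht).2
  have hint : ∀ x y, IntervalIntegrable (fun s => posPow (t - s) a * negPow (u - s) b)
      volume x y := fun x y =>
    intervalIntegrable_mul_of_memLp (memLp_posPow_sub ha t _ _) (memLp_negPow_sub hb u _ _)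
  rcases le_or_gt t u with htu | hut
  · rw [posPow_of_nonpos (by linarith : t - u ≤ 0), mul_zero]
    refine intervalIntegral.integral_zero_ae (Eventually.of_forall fun s _ => ?_)
    rcases le_or_gt t s with h | h
    · rw [posPow_of_nonpos (by linarith), zero_mul]
    · rw [negPow, posPow_of_nonpos (y := -(u - s)) (by linarith), mul_zero]
  · rw [← intervalIntegral.integral_add_adjacent_intervals (hint (-R) u) (hint u R),
      ← intervalIntegral.integral_add_adjacent_intervals (hint u t) (hint t R)]
    have h1 : ∫ s in -R..u, posPow (t - s) a * negPow (u - s) b = 0 := by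
      refine intervalIntegral.integral_zero_ae (Eventually.of_forall fun s hs => ?_)
      rw [Set.uIoc_of_le hu1] at hs
      rw [negPow, posPow_of_nonpos (y := -(u - s)) (by linarith [hs.2]), mul_zero]
    have h3 : ∫ s in t..R, posPow (t - s) a * negPow (u - s) b = 0 := by
      refine intervalIntegral.integral_zero_ae (Eventually.of_forall fun s hs => ?_)
      rw [Set.uIoc_of_le ht2] at hs
      rw [posPow_of_nonpos (y := t - s) (by linarith [hs.1]), zero_mul]
    have hL : 0 < t - u := by linarith
    have h2 := intervalIntegral.mul_integral_comp_sub_mul (a := 0) (b := 1)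
      (f := fun s => posPow (t - s) a * negPow (u - s) b) (t - u) t
    rw [mul_one, mul_zero, sub_zero, show t - (t - u) = u by ring] at h2
    rw [h1, h3, zero_add, add_zero, ← h2]
    have h4 : ∫ x in (0 : ℝ)..1, posPow (t - (t - (t - u) * x)) a *
        negPow (u - (t - (t - u) * x)) b =
        ∫ x in (0 : ℝ)..1, (t - u) ^ (a + b) * (x ^ a * (1 - x) ^ b) := by
      -- The endpoint is discarded because `0 ^ 0 = 1` whereas `posPow 0 0 = 0`.
      have hne : ∀ᵐ x : ℝ, x ≠ 1 := by simp [ae_iff]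
      refine intervalIntegral.integral_congr_ae ?_
      filter_upwards [hne] with x hx1 hx
      rw [Set.uIoc_of_le zero_le_one] at hx
      have hx2 : 0 < 1 - x := by
        have := lt_of_le_of_ne hx.2 hx1
        linarith
      rw [negPow, show t - (t - (t - u) * x) = (t - u) * x by ring,
        show -(u - (t - (t - u) * x)) = (t - u) * (1 - x) by ring,
        posPow_of_pos (mul_pos hL hx.1), posPow_of_pos (mul_pos hL hx2),
        Real.mul_rpow hL.le hx.1.le, Real.mul_rpow hL.le hx2.le, Real.rpow_add hL]
      ring
    rw [h4, intervalIntegral.integral_const_mul,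
      integral_rpow_mul_one_sub_rpow (by linarith) (by linarith), posPow_of_pos hL,
      Real.rpow_add_one hL.ne']
    ring

lemma integral_comp_neg_symm (f : ℝ → ℝ) (R : ℝ) :
    ∫ s in -R..R, f (-s) = ∫ s in -R..R, f s := by
  rw [intervalIntegral.integral_comp_neg, neg_neg]

/-- The finite part of `∫ (x - s)_+^a (-s)_+^b ds`. -/
noncomputable def finitePart (a b x : ℝ) : ℝ :=
  finitePartConst a b * posPow x (a + b + 1) + finitePartConst b a * negPow x (a + b + 1)

/-- The divergent part of `∫_{-R}^R (t - s)_+^a (u - s)_+^b ds`. -/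
noncomputable def divergentPart (a b t u R : ℝ) : ℝ :=
  R ^ (a + b + 1) / (a + b + 1) + R ^ (a + b) * ((a * t + b * u) / (a + b))

/-- Exchanging the two factors reduces to `u ≤ t`, where the integral is `incBeta a b (t - u) (R +
u)`. -/
lemma tendsto_integral_posPow_mul_posPow {a b : ℝ} (ha : -1 / 2 < a) (hb : -1 / 2 < b)
    (hab : a + b ≠ 0) (hab' : a + b < 1) (t u : ℝ) :
    Tendsto (fun R : ℝ => (∫ s in -R..R, posPow (t - s) a * posPow (u - s) b) -
      divergentPart a b t u R) atTop (𝓝 (finitePart a b (t - u))) := by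
  wlog hut : u ≤ t generalizing a b t u
  · have := this hb ha (by rwa [add_comm]) (by linarith) u t (by linarith)
    have e : finitePart b a (u - t) = finitePart a b (t - u) := by
      unfold finitePart negPow
      rw [neg_sub, neg_sub, add_comm b a, add_comm]
    rw [e] at this
    refine this.congr fun R => ?_
    congr 1
    · exact intervalIntegral.integral_congr fun s _ => mul_comm _ _
    · unfold divergentPart
      rw [add_comm b a, add_comm (b * u)]
  · have e : finitePart a b (t - u) = finitePartConst a b * (t - u) ^ (a + b + 1) := by
      unfold finitePart negPow
      rw [posPow_of_nonpos (y := -(t - u)) (by linarith), mul_zero, add_zero]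
      rcases hut.eq_or_lt with rfl | h
      · rw [sub_self, posPow_of_nonpos le_rfl, Real.zero_rpow (by linarith)]
      · rw [posPow_of_pos (by linarith)]
    rw [e]
    refine (tendsto_incBeta_sub (sub_nonneg.mpr hut) (by linarith) (by linarith) hab hab' u).congr' ?_
    filter_upwards [eventually_ge_atTop |u|] with R hR
    rw [integral_posPow_mul_posPow ha hb hut hR, divergentPart]
    field_simp
    ring

/-- The reflection `s ↦ -s` turns negative parts into positive parts and changes the signs of `t`
and `u`. -/
lemma tendsto_integral_negPow_mul_negPow {a b : ℝ} (ha : -1 / 2 < a) (hb : -1 / 2 < b)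
    (hab : a + b ≠ 0) (hab' : a + b < 1) (t u : ℝ) :
    Tendsto (fun R : ℝ => (∫ s in -R..R, negPow (t - s) a * negPow (u - s) b) -
      divergentPart a b (-t) (-u) R) atTop (𝓝 (finitePart a b (u - t))) := by
  have h := tendsto_integral_posPow_mul_posPow ha hb hab hab' (-t) (-u)
  rw [show -t - -u = u - t by ring] at h
  refine h.congr fun R => ?_
  congr 1
  rw [← integral_comp_neg_symm]
  refine intervalIntegral.integral_congr fun s _ => ?_
  simp only [negPow]
  congr 2 <;> ring

lemma tendsto_integral_posPow_mul_negPow {a b : ℝ} (ha : -1 / 2 < a) (hb : -1 / 2 < b)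
    (t u : ℝ) :
    Tendsto (fun R : ℝ => ∫ s in -R..R, posPow (t - s) a * negPow (u - s) b) atTop
      (𝓝 (beta (a + 1) (b + 1) * posPow (t - u) (a + b + 1))) := by
  refine tendsto_const_nhds.congr' ?_
  filter_upwards [eventually_ge_atTop |u|, eventually_ge_atTop |t|] with R hR hR'
  rw [integral_posPow_mul_negPow ha hb hR' hR]

lemma tendsto_integral_negPow_mul_posPow {a b : ℝ} (ha : -1 / 2 < a) (hb : -1 / 2 < b)
    (t u : ℝ) :
    Tendsto (fun R : ℝ => ∫ s in -R..R, negPow (t - s) a * posPow (u - s) b) atTop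
      (𝓝 (beta (b + 1) (a + 1) * posPow (u - t) (a + b + 1))) := by
  have h := tendsto_integral_posPow_mul_negPow hb ha u t
  rw [add_comm b a] at h
  exact h.congr fun R => intervalIntegral.integral_congr fun s _ => mul_comm _ _

/-! ### Two-sided powers -/

/-- `p x_+^b + q x_-^b`. -/
noncomputable def twoSidedPow (p q b x : ℝ) : ℝ := p * posPow x b + q * negPow x b

/-- The finite part of the convolution of two two-sided powers. -/
noncomputable def convFinitePart (p q p' q' a b x : ℝ) : ℝ :=
  p * p' * finitePart a b x + p * q' * (beta (a + 1) (b + 1) * posPow x (a + b + 1)) +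
    q * p' * (beta (b + 1) (a + 1) * posPow (-x) (a + b + 1)) + q * q' * finitePart a b (-x)

lemma memLp_twoSidedPow_sub {c : ℝ} (hc : -1 / 2 < c) (p q t x y : ℝ) :
    MemLp (fun s => twoSidedPow p q c (t - s)) 2 (volume.restrict (Set.uIoc x y)) :=
  ((memLp_posPow_sub hc t x y).const_mul p).add ((memLp_negPow_sub hc t x y).const_mul q)

lemma tendsto_integral_twoSidedPow_mul {a b : ℝ} (ha : -1 / 2 < a) (hb : -1 / 2 < b)
    (hab : a + b ≠ 0) (hab' : a + b < 1) (p q p' q' t u : ℝ) :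
    Tendsto (fun R : ℝ => (∫ s in -R..R, twoSidedPow p q a (t - s) * twoSidedPow p' q' b (u - s)) -
      (p * p' * divergentPart a b t u R + q * q' * divergentPart a b (-t) (-u) R)) atTop
      (𝓝 (convFinitePart p q p' q' a b (t - u))) := by
  have h := ((((tendsto_integral_posPow_mul_posPow ha hb hab hab' t u).const_mul (p * p')).add
    ((tendsto_integral_posPow_mul_negPow ha hb t u).const_mul (p * q'))).add
    ((tendsto_integral_negPow_mul_posPow ha hb t u).const_mul (q * p'))).add
    ((tendsto_integral_negPow_mul_negPow ha hb hab hab' t u).const_mul (q * q'))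
  have e : convFinitePart p q p' q' a b (t - u) = p * p' * finitePart a b (t - u) +
      p * q' * (beta (a + 1) (b + 1) * posPow (t - u) (a + b + 1)) +
      q * p' * (beta (b + 1) (a + 1) * posPow (u - t) (a + b + 1)) +
      q * q' * finitePart a b (u - t) := by
    rw [convFinitePart, neg_sub]
  rw [e]
  refine h.congr fun R => ?_
  have i1 := intervalIntegrable_mul_of_memLp (memLp_posPow_sub ha t (-R) R)
    (memLp_posPow_sub hb u (-R) R)
  have i2 := intervalIntegrable_mul_of_memLp (memLp_posPow_sub ha t (-R) R)
    (memLp_negPow_sub hb u (-R) R)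
  have i3 := intervalIntegrable_mul_of_memLp (memLp_negPow_sub ha t (-R) R)
    (memLp_posPow_sub hb u (-R) R)
  have i4 := intervalIntegrable_mul_of_memLp (memLp_negPow_sub ha t (-R) R)
    (memLp_negPow_sub hb u (-R) R)
  have key : ∫ s in -R..R, twoSidedPow p q a (t - s) * twoSidedPow p' q' b (u - s) =
      ∫ s in -R..R, (p * p' * (posPow (t - s) a * posPow (u - s) b) +
        p * q' * (posPow (t - s) a * negPow (u - s) b) +
        q * p' * (negPow (t - s) a * posPow (u - s) b) +
        q * q' * (negPow (t - s) a * negPow (u - s) b)) := by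
    refine intervalIntegral.integral_congr fun s _ => ?_
    simp only [twoSidedPow]
    ring
  rw [key, intervalIntegral.integral_add (((i1.const_mul _).add (i2.const_mul _)).add
    (i3.const_mul _)) (i4.const_mul _), intervalIntegral.integral_add
    ((i1.const_mul _).add (i2.const_mul _)) (i3.const_mul _),
    intervalIntegral.integral_add (i1.const_mul _) (i2.const_mul _)]
  simp only [intervalIntegral.integral_const_mul]
  ring

/-- The increment `φ(t - s) - φ(-s)` of a two-sided power `φ`. -/
noncomputable def powIncrement (p q b t s : ℝ) : ℝ :=
  twoSidedPow p q b (t - s) - twoSidedPow p q b (-s)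

/-- The covariance function obtained from a pair of two-sided powers. -/
noncomputable def powCov (p q p' q' a b t u : ℝ) : ℝ :=
  convFinitePart p q p' q' a b (t - u) - convFinitePart p q p' q' a b t -
    convFinitePart p q p' q' a b (-u)

lemma memLp_powIncrement_restrict {b : ℝ} (hb : -1 / 2 < b) (p q t x y : ℝ) :
    MemLp (powIncrement p q b t) 2 (volume.restrict (Set.uIoc x y)) := by
  have h := (memLp_twoSidedPow_sub hb p q t x y).sub (memLp_twoSidedPow_sub hb p q 0 x y)
  simp only [zero_sub] at h
  exact h

/-- The product of increments is the second difference of the truncated integrals at `(t, u)`, `(t,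
0)`, `(0, u)`, `(0, 0)`. The divergent parts have no term that mixes `t` with `u`, so they cancel
exactly for each `R`. -/
lemma tendsto_integral_powIncrement_mul {a b : ℝ} (ha : -1 / 2 < a) (hb : -1 / 2 < b)
    (hab : a + b ≠ 0) (hab' : a + b < 1) (p q p' q' t u : ℝ) :
    Tendsto (fun R : ℝ => ∫ s in -R..R, powIncrement p q a t s * powIncrement p' q' b u s) atTop
      (𝓝 (powCov p q p' q' a b t u)) := by
  have L := tendsto_integral_twoSidedPow_mul ha hb hab hab' p q p' q'
  have h := (((L t u).sub (L t 0)).sub (L 0 u)).add (L 0 0)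
  have e : convFinitePart p q p' q' a b (t - u) - convFinitePart p q p' q' a b (t - 0) -
      convFinitePart p q p' q' a b (0 - u) + convFinitePart p q p' q' a b (0 - 0) =
      powCov p q p' q' a b t u := by
    have : convFinitePart p q p' q' a b 0 = 0 := by
      simp [convFinitePart, finitePart, negPow, posPow]
    rw [sub_zero, sub_zero, this, zero_sub, add_zero, powCov]
  rw [e] at h
  refine h.congr fun R => ?_
  have I := fun t u => intervalIntegrable_mul_of_memLp (memLp_twoSidedPow_sub ha p q t (-R) R)
    (memLp_twoSidedPow_sub hb p' q' u (-R) R)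
  have key : ∫ s in -R..R, powIncrement p q a t s * powIncrement p' q' b u s =
      ∫ s in -R..R, (twoSidedPow p q a (t - s) * twoSidedPow p' q' b (u - s) -
        twoSidedPow p q a (t - s) * twoSidedPow p' q' b (0 - s) -
        twoSidedPow p q a (0 - s) * twoSidedPow p' q' b (u - s) +
        twoSidedPow p q a (0 - s) * twoSidedPow p' q' b (0 - s)) := by
    refine intervalIntegral.integral_congr fun s _ => ?_
    simp only [powIncrement, zero_sub]
    ring
  rw [key, intervalIntegral.integral_add (((I t u).sub (I t 0)).sub (I 0 u)) (I 0 0),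
    intervalIntegral.integral_sub ((I t u).sub (I t 0)) (I 0 u),
    intervalIntegral.integral_sub (I t u) (I t 0)]
  unfold divergentPart
  ring

lemma measurable_powIncrement (p q b t : ℝ) : Measurable (powIncrement p q b t) := by
  unfold powIncrement twoSidedPow negPow
  have h : ∀ t : ℝ, Measurable fun s : ℝ => posPow (t - s) b := fun t =>
    (measurable_posPow b).comp (measurable_const.sub measurable_id)
  have h' : ∀ t : ℝ, Measurable fun s : ℝ => posPow (-(t - s)) b := fun t =>
    (measurable_posPow b).comp (measurable_const.sub measurable_id).neg
  have h1 := h 0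
  have h2 := h' 0
  simp only [zero_sub] at h1 h2
  exact (((h t).const_mul p).add ((h' t).const_mul q)).sub ((h1.const_mul p).add (h2.const_mul q))

/-- No decay estimate is needed: the truncated integrals of the square converge by the preceding
limit with equal factors, and convergence for a nonnegative integrand gives integrability. For equal
exponents `a + b ≠ 0` reads `b ≠ 0`. -/
lemma memLp_powIncrement {b : ℝ} (hb : -1 / 2 < b) (hb' : b < 1 / 2) (hb0 : b ≠ 0)
    (p q t : ℝ) : MemLp (powIncrement p q b t) 2 volume := by
  rw [memLp_two_iff_integrable_sq (measurable_powIncrement p q b t).aestronglyMeasurable]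
  have hlim := tendsto_integral_powIncrement_mul hb hb (by intro h; apply hb0; linarith)
    (by linarith) p q p q t t
  have hIoc : ∀ R : ℝ, IntegrableOn (fun s => powIncrement p q b t s ^ 2) (Set.Ioc (-R) R) := by
    intro R
    rcases le_or_gt (-R) R with h | h
    · have := intervalIntegrable_iff.mp (intervalIntegrable_mul_of_memLp
        (memLp_powIncrement_restrict hb p q t (-R) R) (memLp_powIncrement_restrict hb p q t (-R) R))
      rw [Set.uIoc_of_le h] at this
      simpa only [sq] using this
    · rw [Set.Ioc_eq_empty h.not_gt]
      exact integrableOn_empty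
  refine integrable_of_intervalIntegral_norm_tendsto (a := fun R : ℝ => -R) (b := fun R => R)
    (l := atTop) _ hIoc tendsto_neg_atTop_atBot tendsto_id (hlim.congr fun R => ?_)
  refine intervalIntegral.integral_congr fun s _ => ?_
  simp only [Real.norm_eq_abs, sq]
  rw [abs_mul_self]

/-- Square integrability is assumed, not derived, so that a causal factor with exponent `0` (that
is, `H = 1/2`) is covered. -/
lemma integral_powIncrement_mul {a b : ℝ} (ha : -1 / 2 < a) (hb : -1 / 2 < b)
    (hab : a + b ≠ 0) (hab' : a + b < 1) {p q p' q' t u : ℝ}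
    (h1 : MemLp (powIncrement p q a t) 2 volume) (h2 : MemLp (powIncrement p' q' b u) 2 volume) :
    ∫ s, powIncrement p q a t s * powIncrement p' q' b u s = powCov p q p' q' a b t u :=
  tendsto_nhds_unique (intervalIntegral_tendsto_integral (h1.integrable_mul h2)
    tendsto_neg_atTop_atBot tendsto_id)
    (tendsto_integral_powIncrement_mul ha hb hab hab' p q p' q' t u)

/-! ### Evaluation of the constants -/

lemma Gamma_add_one_mul_Gamma_one_sub {s : ℝ} (hs : s ≠ 0) :
    Real.Gamma (s + 1) * Real.Gamma (1 - s) = s * Real.pi / Real.sin (Real.pi * s) := by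
  rw [Real.Gamma_add_one hs, mul_assoc, Real.Gamma_mul_Gamma_one_sub]
  ring

lemma sin_pi_mul_ne_zero {s : ℝ} (hs : s ≠ 0) (h1 : -1 < s) (h2 : s < 1) :
    Real.sin (Real.pi * s) ≠ 0 := by
  have hpi := Real.pi_pos
  intro h
  have := (Real.sin_eq_zero_iff_of_lt_of_lt (by nlinarith) (by nlinarith)).mp h
  rcases mul_eq_zero.mp this with h | h
  · exact hpi.ne' h
  · exact hs h

/-- The reflection formula at `s = a` and `s = a + b` converts `beta (b + 1) (1 - a - b)` into `beta
(a + 1) (b + 1)` and a quotient of sines. For `a = 0` both sides vanish. -/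
lemma finitePartConst_eq {a b : ℝ} (ha : -1 / 2 < a) (ha' : a < 1 / 2) (hb : -1 / 2 < b)
    (hb' : b < 1 / 2) (hab : a + b ≠ 0) :
    finitePartConst a b =
      -(beta (a + 1) (b + 1) * (Real.sin (Real.pi * a) / Real.sin (Real.pi * (a + b)))) := by
  rcases eq_or_ne a 0 with rfl | ha0
  · simp [finitePartConst]
  · have g1 := Gamma_add_one_mul_Gamma_one_sub ha0
    have g2 := Gamma_add_one_mul_Gamma_one_sub hab
    have s1 := sin_pi_mul_ne_zero ha0 (by linarith) (by linarith)
    have s2 := sin_pi_mul_ne_zero hab (by linarith) (by linarith)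
    have e1 : Real.Gamma (b + 1 + (1 - a - b)) = (1 - a) * Real.Gamma (1 - a) := by
      rw [← Real.Gamma_add_one (by linarith)]; ring_nf
    have e2 : Real.Gamma (a + 1 + (b + 1)) = (a + b + 1) * Real.Gamma (a + b + 1) := by
      rw [← Real.Gamma_add_one (by linarith)]; ring_nf
    have p1 := Real.Gamma_pos_of_pos (s := 1 - a) (by linarith)
    have p2 := Real.Gamma_pos_of_pos (s := a + b + 1) (by linarith)
    have p4 : Real.Gamma (1 - a - b) = (a + b) * Real.pi / Real.sin (Real.pi * (a + b)) /
        Real.Gamma (a + b + 1) := by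
      rw [eq_div_iff p2.ne', ← g2]; ring_nf
    have p5 : Real.Gamma (a + 1) = a * Real.pi / Real.sin (Real.pi * a) / Real.Gamma (1 - a) := by
      rw [eq_div_iff p1.ne', ← g1]
    have n1 : (1 - a) ≠ 0 := by linarith
    have n2 : a + b + 1 ≠ 0 := by linarith
    rw [finitePartConst, beta, beta, e1, e2, p4, p5]
    clear g1 g2 p4 p5
    generalize Real.sin (Real.pi * a) = x at *
    generalize Real.sin (Real.pi * (a + b)) = y at *
    field_simp
    ring

/-- The covariance function `(r (t^h + u^h - |t - u|^h) + e (t^h - u^h - sign(t - u)|t - u|^h)) / 2`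
of two jointly self-similar processes with stationary increments. -/
noncomputable def fbmCov (r e h t u : ℝ) : ℝ :=
  (r * (t ^ h + u ^ h - |t - u| ^ h) + e * (t ^ h - u ^ h - Real.sign (t - u) * |t - u| ^ h)) / 2

lemma posPow_eq_half {x h : ℝ} (hh : 0 < h) :
    posPow x h = (|x| ^ h + Real.sign x * |x| ^ h) / 2 := by
  rcases lt_trichotomy x 0 with hx | rfl | hx
  · rw [posPow_of_nonpos hx.le, Real.sign_of_neg hx]; ring
  · simp [posPow, Real.zero_rpow hh.ne']
  · rw [posPow_of_pos hx, Real.sign_of_pos hx, abs_of_pos hx]; ring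

lemma posPow_of_nonneg {x h : ℝ} (hx : 0 ≤ x) (hh : 0 < h) : posPow x h = x ^ h := by
  rcases hx.eq_or_lt with rfl | hx
  · rw [posPow_of_nonpos le_rfl, Real.zero_rpow hh.ne']
  · rw [posPow_of_pos hx]

lemma posPow_neg_of_nonneg {x h : ℝ} (hx : 0 ≤ x) : posPow (-x) h = 0 :=
  posPow_of_nonpos (by linarith) h

lemma powCov_causal {a b t u : ℝ} (hab : 0 < a + b + 1) (ht : 0 ≤ t) (hu : 0 ≤ u) :
    powCov 1 0 1 0 a b t u =
      fbmCov (-(finitePartConst a b + finitePartConst b a))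
        (-(finitePartConst a b - finitePartConst b a)) (a + b + 1) t u := by
  simp only [powCov, convFinitePart, finitePart, negPow, neg_neg, posPow_of_nonneg ht hab,
    posPow_of_nonneg hu hab, posPow_neg_of_nonneg ht, posPow_neg_of_nonneg hu, fbmCov]
  rw [posPow_eq_half (x := t - u) hab, posPow_eq_half (x := -(t - u)) hab, abs_neg,
    Real.sign_neg]
  ring

/-- The kernel is even, so the coefficients on both sides of `0` agree and the asymmetric parameter
is `0`. The mixed products add one Beta term to each side. -/
lemma powCov_wellBalanced {a b t u : ℝ} (hab : 0 < a + b + 1) (ht : 0 ≤ t) (hu : 0 ≤ u) :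
    powCov 1 1 1 1 a b t u =
      fbmCov (-2 * (finitePartConst a b + finitePartConst b a + beta (a + 1) (b + 1))) 0
        (a + b + 1) t u := by
  have hB : beta (b + 1) (a + 1) = beta (a + 1) (b + 1) := by
    unfold beta
    rw [mul_comm, add_comm (b + 1)]
  simp only [powCov, convFinitePart, finitePart, negPow, neg_neg, posPow_of_nonneg ht hab,
    posPow_of_nonneg hu hab, posPow_neg_of_nonneg ht, posPow_neg_of_nonneg hu, fbmCov, hB]
  rw [posPow_eq_half (x := t - u) hab, posPow_eq_half (x := -(t - u)) hab, abs_neg,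
    Real.sign_neg]
  ring

/-- The factor `√(Γ(2H+1) sin(Hπ) Γ(2H'+1) sin(H'π)) / Γ(H+H'+1)`, as a function of a pair of
exponents. -/
noncomputable def pairFactor (H H' : ℝ) : ℝ :=
  √(Real.Gamma (2 * H + 1) * Real.sin (H * Real.pi)) *
    √(Real.Gamma (2 * H' + 1) * Real.sin (H' * Real.pi)) / Real.Gamma (H + H' + 1)

lemma sin_mul_pi_pos {H : ℝ} (h0 : 0 < H) (h1 : H < 1) : 0 < Real.sin (H * Real.pi) :=
  Real.sin_pos_of_pos_of_lt_pi (by positivity) (by nlinarith [Real.pi_pos])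

lemma Gamma_mul_sin_pos {H : ℝ} (h0 : 0 < H) (h1 : H < 1) :
    0 < Real.Gamma (2 * H + 1) * Real.sin (H * Real.pi) :=
  mul_pos (Real.Gamma_pos_of_pos (by linarith)) (sin_mul_pi_pos h0 h1)

lemma pairFactor_self {H : ℝ} (h0 : 0 < H) (h1 : H < 1) :
    pairFactor H H = Real.sin (H * Real.pi) := by
  rw [pairFactor, Real.mul_self_sqrt (Gamma_mul_sin_pos h0 h1).le, ← two_mul]
  have := Real.Gamma_pos_of_pos (s := 2 * H + 1) (by linarith)
  field_simp

lemma pairFactor_comm (H H' : ℝ) : pairFactor H H' = pairFactor H' H := by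
  rw [pairFactor, pairFactor, mul_comm, add_comm H]

lemma gammaFactor_eq_pairFactor {H : Fin 2 → ℝ} (hH : ∀ i, 0 < H i ∧ H i < 1) :
    gammaFactor H = pairFactor (H 0) (H 1) := by
  rw [gammaFactor, pairFactor, ← Real.sqrt_mul (Gamma_mul_sin_pos (hH 0).1 (hH 0).2).le]
  ring_nf

lemma aCausal_mul_aCausal_mul_beta {H H' : ℝ} (h0 : 0 < H) (h0' : 0 < H') :
    aCausal H * aCausal H' * beta (H - 1 / 2 + 1) (H' - 1 / 2 + 1) = pairFactor H H' := by
  have g1 := Real.Gamma_pos_of_pos (s := H + 1 / 2) (by linarith)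
  have g2 := Real.Gamma_pos_of_pos (s := H' + 1 / 2) (by linarith)
  have g3 := Real.Gamma_pos_of_pos (s := H + H' + 1) (by linarith)
  rw [aCausal, aCausal, beta, pairFactor, show H - 1 / 2 + 1 = H + 1 / 2 by ring,
    show H' - 1 / 2 + 1 = H' + 1 / 2 by ring, show H + 1 / 2 + (H' + 1 / 2) = H + H' + 1 by ring]
  field_simp

lemma fbmCov_smul (c r e h t u : ℝ) : c * fbmCov r e h t u = fbmCov (c * r) (c * e) h t u := by
  unfold fbmCov
  ring

lemma sin_half_sum_mul_pi_pos {H H' : ℝ} (h0 : 0 < H) (h1 : H < 1) (h0' : 0 < H') (h1' : H' < 1) :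
    0 < Real.sin ((H + H') / 2 * Real.pi) :=
  sin_mul_pi_pos (by linarith) (by linarith)

lemma cos_half_sum_mul_pi_ne_zero {H H' : ℝ} (h0 : 0 < H) (h1 : H < 1) (h0' : 0 < H') (h1' : H' < 1)
    (hs : H + H' ≠ 1) : Real.cos ((H + H') / 2 * Real.pi) ≠ 0 := by
  have := sin_pi_mul_ne_zero (s := (1 - (H + H')) / 2) (by intro h; apply hs; linarith)
    (by linarith) (by linarith)
  rwa [show Real.pi * ((1 - (H + H')) / 2) = Real.pi / 2 - (H + H') / 2 * Real.pi by ring,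
    Real.sin_pi_div_two_sub] at this

/-! ### Inner products of the normalized kernels -/

lemma kernel_causal (H t s : ℝ) :
    kernel .causal H t s = aCausal H * powIncrement 1 0 (H - 1 / 2) t s := by
  simp [kernel, powIncrement, twoSidedPow, fPlus]

lemma kernel_wellBalanced (H t s : ℝ) :
    kernel .wellBalanced H t s = aWellBalanced H * powIncrement 1 1 (H - 1 / 2) t s := by
  simp only [kernel, powIncrement, twoSidedPow, fPlus, fMinus, negPow]
  ring

/-- Put `π H = x - y` and `π H' = x + y`; the shift by `1/2` turns sines into cosines. The sum gives
the factor in `ρ_jk`, the difference the factor in `η_jk`. -/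
lemma trig_causal {H H' : ℝ} (h0 : 0 < H) (h1 : H < 1) (h0' : 0 < H') (h1' : H' < 1)
    (hs : H + H' ≠ 1) :
    (Real.sin (Real.pi * (H - 1 / 2)) + Real.sin (Real.pi * (H' - 1 / 2))) /
        Real.sin (Real.pi * (H - 1 / 2 + (H' - 1 / 2))) =
      Real.cos ((H' - H) * Real.pi / 2) / Real.sin ((H + H') / 2 * Real.pi) ∧
    (Real.sin (Real.pi * (H - 1 / 2)) - Real.sin (Real.pi * (H' - 1 / 2))) /
        Real.sin (Real.pi * (H - 1 / 2 + (H' - 1 / 2))) =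
      Real.sin ((H' - H) * Real.pi / 2) / Real.cos ((H + H') / 2 * Real.pi) := by
  set x := (H + H') / 2 * Real.pi with hx
  set y := (H' - H) * Real.pi / 2 with hy
  have p := sin_half_sum_mul_pi_pos h0 h1 h0' h1'
  have n := cos_half_sum_mul_pi_ne_zero h0 h1 h0' h1' hs
  rw [← hx] at p n
  have e1 : Real.sin (Real.pi * (H - 1 / 2)) = -Real.cos (x - y) := by
    rw [show Real.pi * (H - 1 / 2) = -(Real.pi / 2 - (x - y)) by rw [hx, hy]; ring, Real.sin_neg,
      Real.sin_pi_div_two_sub]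
  have e2 : Real.sin (Real.pi * (H' - 1 / 2)) = -Real.cos (x + y) := by
    rw [show Real.pi * (H' - 1 / 2) = -(Real.pi / 2 - (x + y)) by rw [hx, hy]; ring, Real.sin_neg,
      Real.sin_pi_div_two_sub]
  have e3 : Real.sin (Real.pi * (H - 1 / 2 + (H' - 1 / 2))) = -(2 * Real.sin x * Real.cos x) := by
    rw [show Real.pi * (H - 1 / 2 + (H' - 1 / 2)) = 2 * x - Real.pi by rw [hx]; ring,
      Real.sin_sub_pi, Real.sin_two_mul]
  rw [e1, e2, e3, Real.cos_sub, Real.cos_add]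
  constructor <;> field_simp <;> ring

lemma kernel_causal_half {t : ℝ} (ht : 0 ≤ t) (s : ℝ) :
    kernel .causal (1 / 2) t s = (Set.Ico 0 t).indicator (fun _ => (1 : ℝ)) s := by
  have ha : aCausal (1 / 2) = 1 := by
    have : Real.sin (1 / 2 * Real.pi) = 1 := by
      rw [show 1 / 2 * Real.pi = Real.pi / 2 by ring, Real.sin_pi_div_two]
    rw [aCausal, this]
    norm_num [Real.Gamma_two]
  simp only [kernel, ha, fPlus, posPow, Set.indicator_apply, Set.mem_Ico, sub_self,
    Real.rpow_zero, one_mul, sub_pos, Left.neg_pos_iff]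
  split_ifs with h1 h2 h3 h4 h5 h6
  all_goals first | (exfalso; grind) | norm_num

lemma memLp_kernel_causal {H t : ℝ} (h0 : 0 < H) (h1 : H < 1) (ht : 0 ≤ t) :
    MemLp (kernel .causal H t) 2 volume := by
  rcases eq_or_ne H (1 / 2) with rfl | h
  · have : kernel .causal (1 / 2) t = (Set.Ico 0 t).indicator (fun _ => (1 : ℝ)) :=
      funext (kernel_causal_half ht)
    rw [this]
    exact memLp_indicator_const 2 measurableSet_Ico 1 (Or.inr (by simp))
  · have : kernel .causal H t = fun s => aCausal H * powIncrement 1 0 (H - 1 / 2) t s :=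
      funext (kernel_causal H t)
    rw [this]
    exact (memLp_powIncrement (by linarith) (by linarith) (sub_ne_zero.mpr h) 1 0 t).const_mul _

lemma memLp_kernel_wellBalanced {H : ℝ} (h0 : 0 < H) (h1 : H < 1) (h : H ≠ 1 / 2) (t : ℝ) :
    MemLp (kernel .wellBalanced H t) 2 volume := by
  have : kernel .wellBalanced H t = fun s => aWellBalanced H * powIncrement 1 1 (H - 1 / 2) t s :=
    funext (kernel_wellBalanced H t)
  rw [this]
  exact (memLp_powIncrement (by linarith) (by linarith) (sub_ne_zero.mpr h) 1 1 t).const_mul _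

lemma memLp_powIncrement_of_memLp_kernel {H t : ℝ} (h0 : 0 < H) (h1 : H < 1)
    (h : MemLp (kernel .causal H t) 2 volume) :
    MemLp (powIncrement 1 0 (H - 1 / 2) t) 2 volume := by
  have ha : aCausal H ≠ 0 :=
    (div_pos (Real.sqrt_pos.mpr (Gamma_mul_sin_pos h0 h1))
      (Real.Gamma_pos_of_pos (by linarith))).ne'
  have : powIncrement 1 0 (H - 1 / 2) t = fun s => (aCausal H)⁻¹ * kernel .causal H t s := by
    funext s
    rw [kernel_causal, inv_mul_cancel_left₀ ha]
  rw [this]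
  exact h.const_mul _

lemma integral_kernel_causal {H H' t u : ℝ} (h0 : 0 < H) (h1 : H < 1) (h0' : 0 < H')
    (h1' : H' < 1) (hs : H + H' ≠ 1) (ht : 0 ≤ t) (hu : 0 ≤ u) :
    ∫ s, kernel .causal H t s * kernel .causal H' u s =
      fbmCov (pairFactor H H' *
          (Real.cos ((H' - H) * Real.pi / 2) / Real.sin ((H + H') / 2 * Real.pi)))
        (pairFactor H H' *
          (Real.sin ((H' - H) * Real.pi / 2) / Real.cos ((H + H') / 2 * Real.pi)))
        (H + H') t u := by
  have m1 := memLp_powIncrement_of_memLp_kernel h0 h1 (memLp_kernel_causal h0 h1 ht)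
  have m2 := memLp_powIncrement_of_memLp_kernel h0' h1' (memLp_kernel_causal h0' h1' hu)
  have hab : H - 1 / 2 + (H' - 1 / 2) ≠ 0 := by intro h; apply hs; linarith
  have hab' : H' - 1 / 2 + (H - 1 / 2) ≠ 0 := by rwa [add_comm]
  have e : ∀ s, kernel .causal H t s * kernel .causal H' u s = aCausal H * aCausal H' *
      (powIncrement 1 0 (H - 1 / 2) t s * powIncrement 1 0 (H' - 1 / 2) u s) := by
    intro s
    rw [kernel_causal, kernel_causal]
    ring
  simp only [e]
  rw [integral_const_mul, integral_powIncrement_mul (by linarith) (by linarith) hab (by linarith)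
    m1 m2, powCov_causal (by linarith) ht hu,
    finitePartConst_eq (by linarith) (by linarith) (by linarith) (by linarith) hab,
    finitePartConst_eq (by linarith) (by linarith) (by linarith) (by linarith) hab', fbmCov_smul,
    ← aCausal_mul_aCausal_mul_beta h0 h0', ← (trig_causal h0 h1 h0' h1' hs).1,
    ← (trig_causal h0 h1 h0' h1' hs).2, add_comm (H' - 1 / 2) (H - 1 / 2)]
  have hB : beta (H' - 1 / 2 + 1) (H - 1 / 2 + 1) = beta (H - 1 / 2 + 1) (H' - 1 / 2 + 1) := by
    unfold beta
    rw [mul_comm, add_comm (H' - 1 / 2 + 1)]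
  rw [hB]
  congr 1 <;> ring

/-- At `H = 1/2` the general formula is unavailable since `H + H = 1`. There the kernels are
indicators, and their overlap `min t u` equals `(t + u - |t - u|) / 2`. -/
lemma integral_kernel_causal_self {H t u : ℝ} (h0 : 0 < H) (h1 : H < 1) (ht : 0 ≤ t)
    (hu : 0 ≤ u) :
    ∫ s, kernel .causal H t s * kernel .causal H u s = fbmCov 1 0 (H + H) t u := by
  rcases eq_or_ne H (1 / 2) with rfl | h
  · have e : ∀ s, kernel .causal (1 / 2) t s * kernel .causal (1 / 2) u s =
        (Set.Ico 0 (min t u)).indicator (fun _ => (1 : ℝ)) s := by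
      intro s
      rw [kernel_causal_half ht, kernel_causal_half hu]
      simp only [Set.indicator_apply, Set.mem_Ico, lt_min_iff]
      split_ifs
      all_goals first | (exfalso; grind) | norm_num
    simp only [e]
    rw [integral_indicator_const _ measurableSet_Ico]
    simp only [fbmCov, add_halves, Real.rpow_one, zero_mul, add_zero, one_mul, Real.volume_real_Ico,
      smul_eq_mul, mul_one, sub_zero]
    rw [max_eq_left (le_min ht hu)]
    rcases le_total t u with htu | htu
    · rw [min_eq_left htu, abs_of_nonpos (by linarith)]
      ring
    · rw [min_eq_right htu, abs_of_nonneg (by linarith)]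
      ring
  · rw [integral_kernel_causal h0 h1 h0 h1 (by intro h'; apply h; linarith) ht hu,
      pairFactor_self h0 h1, add_self_div_two, sub_self, zero_mul, zero_div, Real.cos_zero,
      Real.sin_zero, zero_div, mul_zero, mul_one_div_cancel (sin_mul_pi_pos h0 h1).ne']

/-- The identity `cos (α - β) - cos (α + β) = 2 sin α sin β` splits the numerator into one sine for
each exponent. The normalizing constants can then cancel these sines one by one. -/
lemma powCov_const_wellBalanced {H H' : ℝ} (h0 : 0 < H) (h1 : H < 1) (h0' : 0 < H') (h1' : H' < 1)
    (hs : H + H' ≠ 1) :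
    -2 * (finitePartConst (H - 1 / 2) (H' - 1 / 2) + finitePartConst (H' - 1 / 2) (H - 1 / 2) +
      beta (H - 1 / 2 + 1) (H' - 1 / 2 + 1)) =
      4 * beta (H - 1 / 2 + 1) (H' - 1 / 2 + 1) * Real.sin (Real.pi * (H - 1 / 2) / 2) *
        Real.sin (Real.pi * (H' - 1 / 2) / 2) / Real.sin ((H + H') / 2 * Real.pi) := by
  have hab : H - 1 / 2 + (H' - 1 / 2) ≠ 0 := by intro h; apply hs; linarith
  have hab' : H' - 1 / 2 + (H - 1 / 2) ≠ 0 := by rwa [add_comm]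
  have hB : beta (H' - 1 / 2 + 1) (H - 1 / 2 + 1) = beta (H - 1 / 2 + 1) (H' - 1 / 2 + 1) := by
    unfold beta
    rw [mul_comm, add_comm (H' - 1 / 2 + 1)]
  rw [finitePartConst_eq (by linarith) (by linarith) (by linarith) (by linarith) hab,
    finitePartConst_eq (by linarith) (by linarith) (by linarith) (by linarith) hab', hB,
    add_comm (H' - 1 / 2) (H - 1 / 2)]
  have t1 := (trig_causal h0 h1 h0' h1' hs).1
  have p := sin_half_sum_mul_pi_pos h0 h1 h0' h1'
  set y := (H' - H) * Real.pi / 2 with hy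
  set B := beta (H - 1 / 2 + 1) (H' - 1 / 2 + 1)
  have e1 : Real.cos y = Real.cos (Real.pi * (H - 1 / 2) / 2 - Real.pi * (H' - 1 / 2) / 2) := by
    rw [← Real.cos_neg y, hy]
    ring_nf
  have e2 : Real.sin ((H + H') / 2 * Real.pi) =
      Real.cos (Real.pi * (H - 1 / 2) / 2 + Real.pi * (H' - 1 / 2) / 2) := by
    rw [← Real.cos_sub_pi_div_two]
    ring_nf
  have e3 : -2 * (-(B * (Real.sin (Real.pi * (H - 1 / 2)) /
      Real.sin (Real.pi * (H - 1 / 2 + (H' - 1 / 2))))) +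
      -(B * (Real.sin (Real.pi * (H' - 1 / 2)) /
      Real.sin (Real.pi * (H - 1 / 2 + (H' - 1 / 2))))) + B) =
      2 * B * ((Real.sin (Real.pi * (H - 1 / 2)) + Real.sin (Real.pi * (H' - 1 / 2))) /
        Real.sin (Real.pi * (H - 1 / 2 + (H' - 1 / 2))) - 1) := by ring
  rw [e3, t1]
  have e4 : Real.cos y - Real.sin ((H + H') / 2 * Real.pi) =
      2 * (Real.sin (Real.pi * (H - 1 / 2) / 2) * Real.sin (Real.pi * (H' - 1 / 2) / 2)) := by
    rw [e1, e2, Real.cos_sub, Real.cos_add]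
    ring
  rw [div_sub_one p.ne', e4]
  ring

lemma sin_half_eq_sign_mul_abs {H : ℝ} (h0 : 0 < H) (h1 : H < 1) :
    Real.sin (Real.pi * (H - 1 / 2) / 2) =
      Real.sign (H - 1 / 2) * |Real.sin (Real.pi * (H - 1 / 2) / 2)| := by
  have hpi := Real.pi_pos
  rcases lt_trichotomy (H - 1 / 2) 0 with h | h | h
  · have := Real.sin_neg_of_neg_of_neg_pi_lt (x := Real.pi * (H - 1 / 2) / 2) (by nlinarith)
      (by nlinarith)
    rw [Real.sign_of_neg h, abs_of_neg this]
    ring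
  · rw [h]
    simp
  · have := Real.sin_pos_of_pos_of_lt_pi (x := Real.pi * (H - 1 / 2) / 2) (by nlinarith)
      (by nlinarith)
    rw [Real.sign_of_pos h, abs_of_pos this]
    ring

lemma abs_sin_half_pos {H : ℝ} (h0 : 0 < H) (h1 : H < 1) (h : H ≠ 1 / 2) :
    0 < |Real.sin (Real.pi * (H - 1 / 2) / 2)| := by
  rw [abs_pos, mul_div_assoc]
  exact sin_pi_mul_ne_zero (by intro h'; apply h; linarith) (by linarith) (by linarith)

/-- The integral of the squared kernel is the covariance formula at `t = u = 1` with equal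
exponents. Its square root leaves the absolute value of the half-angle sine. -/
lemma aWellBalanced_eq {H : ℝ} (h0 : 0 < H) (h1 : H < 1) (h : H ≠ 1 / 2) :
    aWellBalanced H = √(Real.Gamma (2 * H + 1) * Real.sin (H * Real.pi)) /
      (2 * |Real.sin (Real.pi * (H - 1 / 2) / 2)| * Real.Gamma (H + 1 / 2)) := by
  have hs : H + H ≠ 1 := by intro h'; apply h; linarith
  have m := memLp_powIncrement (b := H - 1 / 2) (by linarith) (by linarith) (sub_ne_zero.mpr h)
    1 1 1
  have hab : H - 1 / 2 + (H - 1 / 2) ≠ 0 := by intro h; apply hs; linarith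
  have e : ∫ s : ℝ, (fPlus s 1 (H - 1 / 2) + fMinus s 1 (H - 1 / 2)) ^ 2 =
      4 * beta (H - 1 / 2 + 1) (H - 1 / 2 + 1) * Real.sin (Real.pi * (H - 1 / 2) / 2) *
        Real.sin (Real.pi * (H - 1 / 2) / 2) / Real.sin ((H + H) / 2 * Real.pi) := by
    have e1 : ∀ s, (fPlus s 1 (H - 1 / 2) + fMinus s 1 (H - 1 / 2)) ^ 2 =
        powIncrement 1 1 (H - 1 / 2) 1 s * powIncrement 1 1 (H - 1 / 2) 1 s := by
      intro s
      simp only [powIncrement, twoSidedPow, fPlus, fMinus, negPow]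
      ring
    simp only [e1]
    rw [integral_powIncrement_mul (by linarith) (by linarith) hab (by linarith) m m,
      powCov_wellBalanced (by linarith) zero_le_one zero_le_one,
      powCov_const_wellBalanced h0 h1 h0 h1 hs, fbmCov]
    rw [Real.one_rpow, sub_self, abs_zero, Real.zero_rpow (by linarith)]
    ring
  have g1 := Real.Gamma_pos_of_pos (s := H + 1 / 2) (by linarith)
  have g2 := Gamma_mul_sin_pos h0 h1
  have g3 := abs_sin_half_pos h0 h1 h
  have g4 := Real.Gamma_pos_of_pos (s := 2 * H + 1) (by linarith)
  have g5 := sin_mul_pi_pos h0 h1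
  have e2 : 4 * beta (H - 1 / 2 + 1) (H - 1 / 2 + 1) * Real.sin (Real.pi * (H - 1 / 2) / 2) *
        Real.sin (Real.pi * (H - 1 / 2) / 2) / Real.sin ((H + H) / 2 * Real.pi) =
      (2 * |Real.sin (Real.pi * (H - 1 / 2) / 2)| * Real.Gamma (H + 1 / 2)) ^ 2 /
        (Real.Gamma (2 * H + 1) * Real.sin (H * Real.pi)) := by
    rw [mul_pow, mul_pow, sq_abs, beta, show H - 1 / 2 + 1 = H + 1 / 2 by ring,
      show H + 1 / 2 + (H + 1 / 2) = 2 * H + 1 by ring, add_self_div_two]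
    field_simp
    ring
  rw [aWellBalanced, e, e2, Real.sqrt_div (sq_nonneg _), Real.sqrt_sq (by positivity), inv_div]

lemma sign_mul_sign (x y : ℝ) : Real.sign (x * y) = Real.sign x * Real.sign y := by
  rcases lt_trichotomy x 0 with hx | rfl | hx <;> rcases lt_trichotomy y 0 with hy | rfl | hy <;>
    simp [Real.sign_of_neg, Real.sign_of_pos, mul_pos_of_neg_of_neg, mul_neg_of_neg_of_pos,
      mul_neg_of_pos_of_neg, *]

lemma integral_kernel_wellBalanced {H H' t u : ℝ} (h0 : 0 < H) (h1 : H < 1) (h0' : 0 < H')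
    (h1' : H' < 1) (h : H ≠ 1 / 2) (h' : H' ≠ 1 / 2) (hs : H + H' ≠ 1) (ht : 0 ≤ t)
    (hu : 0 ≤ u) :
    ∫ s, kernel .wellBalanced H t s * kernel .wellBalanced H' u s =
      fbmCov (Real.sign ((H - 1 / 2) * (H' - 1 / 2)) *
        (pairFactor H H' / Real.sin ((H + H') / 2 * Real.pi))) 0 (H + H') t u := by
  have hab : H - 1 / 2 + (H' - 1 / 2) ≠ 0 := by intro h; apply hs; linarith
  have m1 := memLp_powIncrement (b := H - 1 / 2) (by linarith) (by linarith) (sub_ne_zero.mpr h)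
    1 1 t
  have m2 := memLp_powIncrement (b := H' - 1 / 2) (by linarith) (by linarith)
    (sub_ne_zero.mpr h') 1 1 u
  have e : ∀ s, kernel .wellBalanced H t s * kernel .wellBalanced H' u s =
      aWellBalanced H * aWellBalanced H' *
      (powIncrement 1 1 (H - 1 / 2) t s * powIncrement 1 1 (H' - 1 / 2) u s) := by
    intro s
    rw [kernel_wellBalanced, kernel_wellBalanced]
    ring
  simp only [e]
  rw [integral_const_mul, integral_powIncrement_mul (by linarith) (by linarith) hab (by linarith)
    m1 m2, powCov_wellBalanced (by linarith) ht hu, fbmCov_smul, mul_zero,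
    powCov_const_wellBalanced h0 h1 h0' h1' hs, aWellBalanced_eq h0 h1 h, aWellBalanced_eq h0' h1' h',
    sign_mul_sign, pairFactor, beta, show H - 1 / 2 + 1 = H + 1 / 2 by ring,
    show H' - 1 / 2 + 1 = H' + 1 / 2 by ring, show H + 1 / 2 + (H' + 1 / 2) = H + H' + 1 by ring,
    show H - 1 / 2 + (H' - 1 / 2) + 1 = H + H' by ring]
  have g1 := Real.Gamma_pos_of_pos (s := H + 1 / 2) (by linarith)
  have g2 := Real.Gamma_pos_of_pos (s := H' + 1 / 2) (by linarith)
  have g3 := Real.Gamma_pos_of_pos (s := H + H' + 1) (by linarith)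
  have p := sin_half_sum_mul_pi_pos h0 h1 h0' h1'
  have q1 := abs_sin_half_pos h0 h1 h
  have q2 := abs_sin_half_pos h0' h1' h'
  have s1 := sin_half_eq_sign_mul_abs h0 h1
  have s2 := sin_half_eq_sign_mul_abs h0' h1'
  -- The normalizations contain absolute values of the half-angle sines, the covariance the sines
  -- themselves; the quotients are the signs in `ρ_jk`.
  congr 1
  generalize |Real.sin (Real.pi * (H - 1 / 2) / 2)| = z1 at *
  generalize |Real.sin (Real.pi * (H' - 1 / 2) / 2)| = z2 at *
  rw [s1, s2]
  field_simp
  ring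

/-- The covariance parameters between the normalized components `j` and `k` driven by the same
noise. -/
lemma integral_kernel_mul {m : Model} {H : Fin 2 → ℝ} (hH : ∀ i, 0 < H i ∧ H i < 1)
    (hsum : H 0 + H 1 ≠ 1) (hwb : m = Model.wellBalanced → ∀ i, H i ≠ 1 / 2) (j k : Fin 2)
    {t u : ℝ} (ht : 0 ≤ t) (hu : 0 ≤ u) :
    ∫ s, kernel m (H j) t s * kernel m (H k) u s =
      fbmCov (rhoParam m H 1 j k) (etaParam m H 1 j k) (H j + H k) t u := by
  by_cases hjk : j = k
  · subst hjk
    simp only [rhoParam, etaParam, if_true]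
    cases m with
    | causal => exact integral_kernel_causal_self (hH j).1 (hH j).2 ht hu
    | wellBalanced =>
      have h := hwb rfl j
      have hp := sin_mul_pi_pos (hH j).1 (hH j).2
      rw [integral_kernel_wellBalanced (hH j).1 (hH j).2 (hH j).1 (hH j).2 h h
        (by intro h'; apply h; linarith) ht hu, pairFactor_self (hH j).1 (hH j).2,
        add_self_div_two, div_self hp.ne', mul_one,
        Real.sign_of_pos (mul_self_pos.mpr (sub_ne_zero.mpr h))]
  · have hs : H j + H k ≠ 1 := by
      fin_cases j <;> fin_cases k <;> simp_all [add_comm]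
    have hF : gammaFactor H = pairFactor (H j) (H k) := by
      rw [gammaFactor_eq_pairFactor hH]
      fin_cases j <;> fin_cases k <;> simp_all [pairFactor_comm]
    have hadd : H 0 + H 1 = H j + H k := by
      fin_cases j <;> fin_cases k <;> simp_all [add_comm]
    simp only [rhoParam, etaParam, if_neg hjk, hF, hadd]
    cases m with
    | causal =>
      have hc : Real.cos ((H 1 - H 0) * Real.pi / 2) = Real.cos ((H k - H j) * Real.pi / 2) := by
        fin_cases j <;> fin_cases k <;> simp_all
        rw [← Real.cos_neg]
        ring_nf
      rw [integral_kernel_causal (hH j).1 (hH j).2 (hH k).1 (hH k).2 hs ht hu]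
      simp only [hc]
      congr 1 <;> ring
    | wellBalanced =>
      have hm : (H 0 - 1 / 2) * (H 1 - 1 / 2) = (H j - 1 / 2) * (H k - 1 / 2) := by
        fin_cases j <;> fin_cases k <;> simp_all [mul_comm]
      rw [integral_kernel_wellBalanced (hH j).1 (hH j).2 (hH k).1 (hH k).2 (hwb rfl j) (hwb rfl k)
        hs ht hu]
      simp only [hm, one_mul]

lemma memLp_kernel {m : Model} {H t : ℝ} (h0 : 0 < H) (h1 : H < 1)
    (hwb : m = Model.wellBalanced → H ≠ 1 / 2) (ht : 0 ≤ t) : MemLp (kernel m H t) 2 volume := by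
  cases m with
  | causal => exact memLp_kernel_causal h0 h1 ht
  | wellBalanced => exact memLp_kernel_wellBalanced h0 h1 (hwb rfl) t

/-! ### The Wiener isometry -/

section Wiener

variable {Ω : Type*} [MeasurableSpace Ω]

lemma tendsto_integral_mul_of_tendsto_eLpNorm {f g : ℕ → Ω → ℝ} {f₀ g₀ : Ω → ℝ} {μ : Measure Ω}
    (hf : ∀ n, MemLp (f n) 2 μ) (hf₀ : MemLp f₀ 2 μ) (hg : ∀ n, MemLp (g n) 2 μ)
    (hg₀ : MemLp g₀ 2 μ)
    (hft : Tendsto (fun n => eLpNorm (fun x => f n x - f₀ x) 2 μ) atTop (𝓝 0))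
    (hgt : Tendsto (fun n => eLpNorm (fun x => g n x - g₀ x) 2 μ) atTop (𝓝 0)) :
    Tendsto (fun n => ∫ x, f n x * g n x ∂μ) atTop (𝓝 (∫ x, f₀ x * g₀ x ∂μ)) := by
  have h1 := (Lp.tendsto_Lp_iff_tendsto_eLpNorm'' f hf f₀ hf₀).mpr hft
  have h2 := (Lp.tendsto_Lp_iff_tendsto_eLpNorm'' g hg g₀ hg₀).mpr hgt
  have key : ∀ {u v : Ω → ℝ} (hu : MemLp u 2 μ) (hv : MemLp v 2 μ),
      inner ℝ (hu.toLp u) (hv.toLp v) = ∫ x, u x * v x ∂μ := by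
    intro u v hu hv
    rw [L2.inner_def]
    refine integral_congr_ae ?_
    filter_upwards [hu.coeFn_toLp, hv.coeFn_toLp] with x hx hy
    rw [hx, hy, real_inner_eq_re_inner, RCLike.inner_apply]
    simp [mul_comm]
  have h3 := h1.inner h2 (𝕜 := ℝ)
  simp only [key] at h3
  exact h3

lemma memLp_of_tendsto_eLpNorm {f : ℕ → Ω → ℝ} {f₀ : Ω → ℝ} {μ : Measure Ω}
    (hf : ∀ n, MemLp (f n) 2 μ) (hf₀ : AEStronglyMeasurable f₀ μ)
    (hft : Tendsto (fun n => eLpNorm (fun x => f n x - f₀ x) 2 μ) atTop (𝓝 0)) :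
    MemLp f₀ 2 μ := by
  obtain ⟨n, hn⟩ := (hft.eventually (gt_mem_nhds ENNReal.zero_lt_top)).exists
  have h1 : MemLp (fun x => f n x - f₀ x) 2 μ := ⟨(hf n).1.sub hf₀, hn⟩
  refine ((hf n).sub h1).ae_eq (Eventually.of_forall fun x => ?_)
  simp

/-- Stated for arbitrary families so that it serves twice: for Brownian motion under `P` and for
`orientedIndicator` under Lebesgue measure. -/
lemma integral_sum_increments_mul {μ : Measure Ω} {ι κ : Type*} [Fintype ι] [Fintype κ]
    {X Y : ℝ → Ω → ℝ} (hX : ∀ a, MemLp (X a) 2 μ) (hY : ∀ a, MemLp (Y a) 2 μ)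
    (c l r : ι → ℝ) (c' l' r' : κ → ℝ) :
    ∫ ω, (∑ i, c i * (X (r i) ω - X (l i) ω)) * (∑ j, c' j * (Y (r' j) ω - Y (l' j) ω)) ∂μ =
      ∑ i, ∑ j, c i * c' j * (∫ ω, X (r i) ω * Y (r' j) ω ∂μ - ∫ ω, X (r i) ω * Y (l' j) ω ∂μ -
        ∫ ω, X (l i) ω * Y (r' j) ω ∂μ + ∫ ω, X (l i) ω * Y (l' j) ω ∂μ) := by
  have I : ∀ a b, Integrable (fun ω => X a ω * Y b ω) μ := fun a b => (hX a).integrable_mul (hY b)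
  have J : ∀ i j, Integrable (fun ω => X (r i) ω * Y (r' j) ω - X (r i) ω * Y (l' j) ω -
      X (l i) ω * Y (r' j) ω + X (l i) ω * Y (l' j) ω) μ := fun i j =>
    (((I _ _).sub (I _ _)).sub (I _ _)).add (I _ _)
  have e : ∀ ω, (∑ i, c i * (X (r i) ω - X (l i) ω)) * (∑ j, c' j * (Y (r' j) ω - Y (l' j) ω)) =
      ∑ i, ∑ j, c i * c' j * (X (r i) ω * Y (r' j) ω - X (r i) ω * Y (l' j) ω -
        X (l i) ω * Y (r' j) ω + X (l i) ω * Y (l' j) ω) := by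
    intro ω
    rw [Finset.sum_mul_sum]
    refine Finset.sum_congr rfl fun i _ => Finset.sum_congr rfl fun j _ => ?_
    ring
  simp only [e]
  rw [integral_finsetSum _ fun i _ => integrable_finsetSum _ fun j _ => (J i j).const_mul _]
  refine Finset.sum_congr rfl fun i _ => ?_
  rw [integral_finsetSum _ fun j _ => (J i j).const_mul _]
  refine Finset.sum_congr rfl fun j _ => ?_
  have h1 := (I (r i) (r' j)).sub (I (r i) (l' j))
  have h2 := h1.sub (I (l i) (r' j))
  simp only [Pi.sub_def] at h1 h2
  rw [integral_const_mul, integral_add h2 (I _ _), integral_sub h1 (I _ _),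
    integral_sub (I _ _) (I _ _)]

/-- The indicator of the oriented interval from `0` to `a`. -/
noncomputable def orientedIndicator (a x : ℝ) : ℝ :=
  (Set.Ioc 0 a).indicator (fun _ => (1 : ℝ)) x - (Set.Ioc a 0).indicator (fun _ => (1 : ℝ)) x

lemma indicator_Ioc_eq_orientedIndicator_sub {l r : ℝ} (h : l ≤ r) (x : ℝ) :
    (Set.Ioc l r).indicator (fun _ => (1 : ℝ)) x =
      orientedIndicator r x - orientedIndicator l x := by
  simp only [orientedIndicator, Set.indicator_apply, Set.mem_Ioc]
  split_ifs
  all_goals first | (exfalso; grind) | norm_num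

lemma memLp_orientedIndicator (a : ℝ) : MemLp (orientedIndicator a) 2 volume :=
  (memLp_indicator_const 2 measurableSet_Ioc 1 (Or.inr (by simp))).sub
    (memLp_indicator_const 2 measurableSet_Ioc 1 (Or.inr (by simp)))

lemma integral_indicator_Ioc_one {a b : ℝ} (h : a ≤ b) :
    ∫ x, (Set.Ioc a b).indicator (fun _ => (1 : ℝ)) x = b - a := by
  rw [integral_indicator_const _ measurableSet_Ioc, Real.volume_real_Ioc_of_le h, smul_eq_mul,
    mul_one]

lemma integral_orientedIndicator_mul_of_nonneg {a b : ℝ} (ha : 0 ≤ a) (hb : 0 ≤ b) :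
    ∫ x, orientedIndicator a x * orientedIndicator b x = min a b := by
  have e : ∀ x, orientedIndicator a x * orientedIndicator b x =
      (Set.Ioc 0 (min a b)).indicator (fun _ => (1 : ℝ)) x := by
    intro x
    simp only [orientedIndicator, Set.indicator_apply, Set.mem_Ioc, le_min_iff]
    split_ifs
    all_goals first | (exfalso; grind) | norm_num
  simp only [e]
  rw [integral_indicator_Ioc_one (le_min ha hb), sub_zero]

lemma integral_orientedIndicator_mul_of_nonpos {a b : ℝ} (ha : a ≤ 0) (hb : b ≤ 0) :
    ∫ x, orientedIndicator a x * orientedIndicator b x = min (-a) (-b) := by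
  have e : ∀ x, orientedIndicator a x * orientedIndicator b x =
      (Set.Ioc (max a b) 0).indicator (fun _ => (1 : ℝ)) x := by
    intro x
    simp only [orientedIndicator, Set.indicator_apply, Set.mem_Ioc, max_lt_iff]
    split_ifs
    all_goals first | (exfalso; grind) | norm_num
  simp only [e]
  rw [integral_indicator_Ioc_one (max_le ha hb), zero_sub, min_neg_neg]

lemma integral_orientedIndicator_mul_of_nonneg_of_nonpos {a b : ℝ} (ha : 0 ≤ a) (hb : b ≤ 0) :
    ∫ x, orientedIndicator a x * orientedIndicator b x = 0 := by
  have e : ∀ x, orientedIndicator a x * orientedIndicator b x = 0 := by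
    intro x
    simp only [orientedIndicator, Set.indicator_apply, Set.mem_Ioc]
    split_ifs
    all_goals first | (exfalso; grind) | norm_num
  simp only [e, integral_zero]

/-! ### Second moments of two-sided Brownian motion and of elementary integrals -/

variable {P : Measure Ω}

lemma memLp_of_isBrownianReal {B : ℝ≥0 → Ω → ℝ} (hB : IsBrownianReal B P) (t : ℝ≥0) :
    MemLp (B t) 2 P :=
  (hB.isGaussianProcess.hasGaussianLaw_eval t).memLp_two

lemma integral_mul_of_isBrownianReal [IsProbabilityMeasure P] {B : ℝ≥0 → Ω → ℝ} (hB : IsBrownianReal B P) (s t : ℝ≥0) :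
    ∫ ω, B s ω * B t ω ∂P = min (s : ℝ) t := by
  have h := covariance_eq_sub (memLp_of_isBrownianReal hB s) (memLp_of_isBrownianReal hB t)
  rw [hB.covariance_eval, hB.integral_eval, zero_mul, sub_zero] at h
  rw [← NNReal.coe_min, h]
  rfl

variable {W W' : ℝ → Ω → ℝ}

lemma exists_eq_neg_coe {t : ℝ} (ht : t ≤ 0) : ∃ u : ℝ≥0, t = -(u : ℝ) :=
  ⟨⟨-t, by linarith⟩, (neg_neg t).symm⟩

lemma IsTwoSidedBrownianMotion.memLp (hW : IsTwoSidedBrownianMotion W P) (t : ℝ) :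
    MemLp (W t) 2 P := by
  rcases le_total 0 t with h | h
  · exact memLp_of_isBrownianReal hW.forward ⟨t, h⟩
  · obtain ⟨u, rfl⟩ := exists_eq_neg_coe h
    exact memLp_of_isBrownianReal hW.backward u

lemma IsTwoSidedBrownianMotion.integral_eq_zero (hW : IsTwoSidedBrownianMotion W P) (t : ℝ) :
    ∫ ω, W t ω ∂P = 0 := by
  rcases le_total 0 t with h | h
  · exact hW.forward.integral_eval ⟨t, h⟩
  · obtain ⟨u, rfl⟩ := exists_eq_neg_coe h
    exact hW.backward.integral_eval u

lemma IsTwoSidedBrownianMotion.integral_mul_of_nonneg_of_nonpos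
    (hW : IsTwoSidedBrownianMotion W P) {s t : ℝ} (hs : 0 ≤ s) (ht : t ≤ 0) :
    ∫ ω, W s ω * W t ω ∂P = 0 := by
  lift s to ℝ≥0 using hs
  obtain ⟨u, rfl⟩ := exists_eq_neg_coe ht
  have h := hW.indep.comp (measurable_pi_apply s) (measurable_pi_apply u)
  simp only [Function.comp_def] at h
  rw [h.integral_fun_mul_eq_mul_integral (hW.memLp _).1 (hW.memLp _).1, hW.integral_eq_zero,
    zero_mul]

/-- Brownian motion and the oriented indicators have the same Gram matrix: `min` of the absolute
values on one half-line, `0` across the origin. The isometry for step functions becomes pure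
bilinearity. -/
lemma IsTwoSidedBrownianMotion.integral_mul [IsProbabilityMeasure P] (hW : IsTwoSidedBrownianMotion W P) (s t : ℝ) :
    ∫ ω, W s ω * W t ω ∂P = ∫ x, orientedIndicator s x * orientedIndicator t x := by
  rcases le_total 0 s with hs | hs <;> rcases le_total 0 t with ht | ht
  · rw [integral_orientedIndicator_mul_of_nonneg hs ht]
    exact integral_mul_of_isBrownianReal hW.forward ⟨s, hs⟩ ⟨t, ht⟩
  · rw [integral_orientedIndicator_mul_of_nonneg_of_nonpos hs ht,
      hW.integral_mul_of_nonneg_of_nonpos hs ht]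
  · simp only [mul_comm (W s _), mul_comm (orientedIndicator s _)]
    rw [integral_orientedIndicator_mul_of_nonneg_of_nonpos ht hs,
      hW.integral_mul_of_nonneg_of_nonpos ht hs]
  · rw [integral_orientedIndicator_mul_of_nonpos hs ht]
    obtain ⟨u, rfl⟩ := exists_eq_neg_coe hs
    obtain ⟨v, rfl⟩ := exists_eq_neg_coe ht
    rw [neg_neg, neg_neg]
    exact integral_mul_of_isBrownianReal hW.backward u v

lemma StepFunction.eval_eq (φ : StepFunction) (x : ℝ) :
    φ.eval x = ∑ i, φ.coeff i *
      (orientedIndicator (φ.right i) x - orientedIndicator (φ.left i) x) :=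
  Finset.sum_congr rfl fun i _ => by
    rw [indicator_Ioc_eq_orientedIndicator_sub (φ.left_le_right i)]

lemma StepFunction.memLp_eval (φ : StepFunction) : MemLp φ.eval 2 volume := by
  have : φ.eval = fun x => ∑ i, φ.coeff i *
      (orientedIndicator (φ.right i) x - orientedIndicator (φ.left i) x) := funext φ.eval_eq
  rw [this]
  exact memLp_finsetSum _ fun i _ =>
    ((memLp_orientedIndicator _).sub (memLp_orientedIndicator _)).const_mul _

lemma StepFunction.memLp_integral (φ : StepFunction) (hW : IsTwoSidedBrownianMotion W P) :
    MemLp (φ.integral W) 2 P :=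
  memLp_finsetSum _ fun _ _ => ((hW.memLp _).sub (hW.memLp _)).const_mul _

lemma StepFunction.integral_integral_mul [IsProbabilityMeasure P] (φ ψ : StepFunction)
    (hW : IsTwoSidedBrownianMotion W P) :
    ∫ ω, φ.integral W ω * ψ.integral W ω ∂P = ∫ x, φ.eval x * ψ.eval x := by
  simp only [StepFunction.eval_eq, StepFunction.integral]
  rw [integral_sum_increments_mul hW.memLp hW.memLp,
    integral_sum_increments_mul memLp_orientedIndicator memLp_orientedIndicator]
  simp only [hW.integral_mul]

lemma StepFunction.integral_integral_mul_of_indepFun (φ ψ : StepFunction)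
    (hW : IsTwoSidedBrownianMotion W P) (hW' : IsTwoSidedBrownianMotion W' P)
    (h : IndepFun (fun ω (t : ℝ) => W t ω) (fun ω (t : ℝ) => W' t ω) P) :
    ∫ ω, φ.integral W ω * ψ.integral W' ω ∂P = 0 := by
  have h0 : ∀ s t, ∫ ω, W s ω * W' t ω ∂P = 0 := by
    intro s t
    have h := h.comp (measurable_pi_apply s) (measurable_pi_apply t)
    simp only [Function.comp_def] at h
    rw [h.integral_fun_mul_eq_mul_integral (hW.memLp s).1 (hW'.memLp t).1, hW.integral_eq_zero,
      zero_mul]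
  simp only [StepFunction.integral]
  rw [integral_sum_increments_mul hW.memLp hW'.memLp]
  simp [h0]

lemma IsWienerIntegral.memLp {g : ℝ → ℝ} {X : Ω → ℝ} (hW : IsTwoSidedBrownianMotion W P)
    (hX : IsWienerIntegral W P g X) : MemLp X 2 P := by
  obtain ⟨hm, φ, -, h2⟩ := hX
  exact memLp_of_tendsto_eLpNorm (fun n => (φ n).memLp_integral hW) hm h2

/-- The Wiener isometry. -/
lemma IsWienerIntegral.integral_mul [IsProbabilityMeasure P] {g g' : ℝ → ℝ} {X X' : Ω → ℝ}
    (hW : IsTwoSidedBrownianMotion W P) (hX : IsWienerIntegral W P g X)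
    (hX' : IsWienerIntegral W P g' X') (hg : MemLp g 2 volume) (hg' : MemLp g' 2 volume) :
    ∫ ω, X ω * X' ω ∂P = ∫ x, g x * g' x := by
  have m := hX.memLp hW
  have m' := hX'.memLp hW
  obtain ⟨-, φ, h1, h2⟩ := hX
  obtain ⟨-, ψ, h1', h2'⟩ := hX'
  have l1 := tendsto_integral_mul_of_tendsto_eLpNorm (fun n => (φ n).memLp_integral hW) m
    (fun n => (ψ n).memLp_integral hW) m' h2 h2'
  have l2 := tendsto_integral_mul_of_tendsto_eLpNorm (fun n => (φ n).memLp_eval) hg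
    (fun n => (ψ n).memLp_eval) hg' h1 h1'
  -- The isometry for step functions makes the two approximating sequences of inner products equal,
  -- hence also their limits.
  simp only [StepFunction.integral_integral_mul _ _ hW] at l1
  exact tendsto_nhds_unique l1 l2

lemma IsWienerIntegral.integral_mul_of_indepFun {g g' : ℝ → ℝ} {X X' : Ω → ℝ}
    (hW : IsTwoSidedBrownianMotion W P) (hW' : IsTwoSidedBrownianMotion W' P)
    (h : IndepFun (fun ω (t : ℝ) => W t ω) (fun ω (t : ℝ) => W' t ω) P)
    (hX : IsWienerIntegral W P g X) (hX' : IsWienerIntegral W' P g' X') :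
    ∫ ω, X ω * X' ω ∂P = 0 := by
  have m := hX.memLp hW
  have m' := hX'.memLp hW'
  obtain ⟨-, φ, -, h2⟩ := hX
  obtain ⟨-, ψ, -, h2'⟩ := hX'
  have l1 := tendsto_integral_mul_of_tendsto_eLpNorm (fun n => (φ n).memLp_integral hW) m
    (fun n => (ψ n).memLp_integral hW') m' h2 h2'
  simp only [StepFunction.integral_integral_mul_of_indepFun _ _ hW hW' h] at l1
  exact tendsto_nhds_unique l1 tendsto_const_nhds

/-! ### The covariance of two-dimensional fractional Brownian motion -/

lemma matrixKernel_apply (m : Model) (H σ : Fin 2 → ℝ) (ρ t s : ℝ) (j l : Fin 2) :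
    matrixKernel m H σ ρ t s j l = σ j * mixing ρ j l * kernel m (H j) t s := by
  rw [matrixKernel, Matrix.diagonal_mul]
  ring

/-- This is the correlation matrix of the two mixed noises; `|ρ| ≤ 1` makes the square root genuine.
-/
lemma mixing_mul_transpose {ρ : ℝ} (hρ : |ρ| ≤ 1) (j k : Fin 2) :
    mixing ρ j 0 * mixing ρ k 0 + mixing ρ j 1 * mixing ρ k 1 = if j = k then 1 else ρ := by
  have h : 0 ≤ 1 - ρ ^ 2 := by
    have := (sq_le_one_iff_abs_le_one ρ).mpr hρ
    linarith
  fin_cases j <;> fin_cases k <;> simp [mixing, Real.mul_self_sqrt h]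
  ring

/-- Off the diagonal the parameter is linear in `ρ`, so the inner products of kernels need only be
known for `ρ = 1`. -/
lemma rhoParam_eq (m : Model) (H : Fin 2 → ℝ) (ρ : ℝ) (j k : Fin 2) :
    rhoParam m H ρ j k = (if j = k then 1 else ρ) * rhoParam m H 1 j k := by
  unfold rhoParam
  split_ifs
  · ring
  · cases m <;> simp only <;> ring

lemma etaParam_eq (m : Model) (H : Fin 2 → ℝ) (ρ : ℝ) (j k : Fin 2) :
    etaParam m H ρ j k = (if j = k then 1 else ρ) * etaParam m H 1 j k := by
  unfold etaParam
  split_ifs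
  · ring
  · cases m <;> simp only <;> ring

variable {m : Model} {H σ : Fin 2 → ℝ} {ρ : ℝ} {Z : Fin 2 → ℝ → Ω → ℝ}

lemma IsFBm2D.memLp (hZ : IsFBm2D m H σ ρ Z P) {t : ℝ} (ht : 0 ≤ t) (j : Fin 2) :
    MemLp (Z j t) 2 P := by
  obtain ⟨W, hW, -, h⟩ := hZ
  obtain ⟨Y, hY, hZY⟩ := h t ht j
  exact (memLp_finsetSum Finset.univ fun l _ => (hY l).memLp (hW l)).ae_eq hZY.symm

/-- The covariance function of two-dimensional fractional Brownian motion. -/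
theorem IsFBm2D.integral_mul [IsProbabilityMeasure P] (hZ : IsFBm2D m H σ ρ Z P) (hH : ∀ i, 0 < H i ∧ H i < 1)
    (hρ : |ρ| ≤ 1) (hsum : H 0 + H 1 ≠ 1) (hwb : m = Model.wellBalanced → ∀ i, H i ≠ 1 / 2)
    (j k : Fin 2) {t s : ℝ} (ht : 0 ≤ t) (hs : 0 ≤ s) :
    ∫ ω, Z j t ω * Z k s ω ∂P =
      σ j * σ k * fbmCov (rhoParam m H ρ j k) (etaParam m H ρ j k) (H j + H k) t s := by
  obtain ⟨W, hW, hind, h⟩ := hZ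
  obtain ⟨Y, hY, hZY⟩ := h t ht j
  obtain ⟨Y', hY', hZY'⟩ := h s hs k
  have mY := fun l => (hY l).memLp (hW l)
  have mY' := fun l => (hY' l).memLp (hW l)
  have e : ∫ ω, Z j t ω * Z k s ω ∂P = ∫ ω, (Y 0 ω * Y' 0 ω + Y 0 ω * Y' 1 ω + Y 1 ω * Y' 0 ω +
      Y 1 ω * Y' 1 ω) ∂P := by
    refine integral_congr_ae ?_
    filter_upwards [hZY, hZY'] with ω h1 h2
    rw [h1, h2, Fin.sum_univ_two, Fin.sum_univ_two]
    ring
  have I : ∀ l l', Integrable (fun ω => Y l ω * Y' l' ω) P := fun l l' =>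
    (mY l).integrable_mul (mY' l')
  have h1 := (I 0 0).add (I 0 1)
  have h2 := h1.add (I 1 0)
  simp only [Pi.add_def] at h1 h2
  rw [e, integral_add h2 (I _ _), integral_add h1 (I _ _), integral_add (I _ _) (I _ _)]
  have mk : ∀ i u, 0 ≤ u → MemLp (kernel m (H i) u) 2 volume := fun i u hu =>
    memLp_kernel (hH i).1 (hH i).2 (fun hm => hwb hm i) hu
  have key : ∀ l, ∫ ω, Y l ω * Y' l ω ∂P = σ j * σ k * (mixing ρ j l * mixing ρ k l) *
      fbmCov (rhoParam m H 1 j k) (etaParam m H 1 j k) (H j + H k) t s := by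
    intro l
    have h1 := hY l
    have h2 := hY' l
    simp only [matrixKernel_apply] at h1 h2
    rw [h1.integral_mul (hW l) h2 ((mk j t ht).const_mul _) ((mk k s hs).const_mul _)]
    have e2 : ∀ x, σ j * mixing ρ j l * kernel m (H j) t x *
        (σ k * mixing ρ k l * kernel m (H k) s x) = σ j * σ k * (mixing ρ j l * mixing ρ k l) *
        (kernel m (H j) t x * kernel m (H k) s x) := fun x => by ring
    simp only [e2]
    rw [integral_const_mul, integral_kernel_mul hH hsum hwb j k ht hs]
  rw [key, key, (hY 0).integral_mul_of_indepFun (hW 0) (hW 1) hind (hY' 1),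
    (hY 1).integral_mul_of_indepFun (hW 1) (hW 0) hind.symm (hY' 0), rhoParam_eq m H ρ,
    etaParam_eq m H ρ, ← fbmCov_smul, ← mixing_mul_transpose hρ]
  ring

end Wiener

/-! ### Moments of sine and cosine -/

lemma hasDerivAt_sinMoment {h : ℝ} (hh : 0 < h) (w : ℝ) :
    HasDerivAt (sinMoment h) (∫ x in (0 : ℝ)..1, x * Real.cos (w * x) * x ^ h) w := by
  have hc : Continuous fun x : ℝ => x ^ h := Real.continuous_rpow_const hh.le
  refine (intervalIntegral.hasDerivAt_integral_of_dominated_loc_of_deriv_le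
    (F := fun w x => Real.sin (w * x) * x ^ h) (F' := fun w x => x * Real.cos (w * x) * x ^ h)
    (bound := fun _ => 1) Filter.univ_mem ?_ ?_ ?_ ?_ ?_ ?_).2
  · exact Eventually.of_forall fun w => Continuous.aestronglyMeasurable (by fun_prop)
  · exact Continuous.intervalIntegrable (by fun_prop) _ _
  · exact Continuous.aestronglyMeasurable (by fun_prop)
  · refine Eventually.of_forall fun x hx w _ => ?_
    rw [Set.uIoc_of_le zero_le_one] at hx
    rw [Real.norm_eq_abs, abs_mul, abs_mul, abs_of_pos hx.1,
      abs_of_nonneg (Real.rpow_nonneg hx.1.le h)]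
    have h1 := Real.abs_cos_le_one (w * x)
    have h2 := Real.rpow_le_one hx.1.le hx.2 hh.le
    have h3 := Real.rpow_nonneg hx.1.le h
    have h4 : x * |Real.cos (w * x)| ≤ 1 := mul_le_one₀ hx.2 (abs_nonneg _) h1
    exact mul_le_one₀ h4 h3 h2
  · exact continuous_const.intervalIntegrable _ _
  · refine Eventually.of_forall fun x _ w _ => ?_
    have := ((hasDerivAt_id w).mul_const x).sin.mul_const (x ^ h)
    exact this.congr_deriv (by simp [mul_comm])

lemma hasDerivAt_cosMoment {h : ℝ} (hh : 0 < h) (w : ℝ) :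
    HasDerivAt (cosMoment h) (-∫ x in (0 : ℝ)..1, x * Real.sin (w * x) * x ^ h) w := by
  have hc : Continuous fun x : ℝ => x ^ h := Real.continuous_rpow_const hh.le
  rw [← intervalIntegral.integral_neg]
  refine (intervalIntegral.hasDerivAt_integral_of_dominated_loc_of_deriv_le
    (F := fun w x => Real.cos (w * x) * x ^ h) (F' := fun w x => -(x * Real.sin (w * x) * x ^ h))
    (bound := fun _ => 1) Filter.univ_mem ?_ ?_ ?_ ?_ ?_ ?_).2
  · exact Eventually.of_forall fun w => Continuous.aestronglyMeasurable (by fun_prop)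
  · exact Continuous.intervalIntegrable (by fun_prop) _ _
  · exact Continuous.aestronglyMeasurable (by fun_prop)
  · refine Eventually.of_forall fun x hx w _ => ?_
    rw [Set.uIoc_of_le zero_le_one] at hx
    rw [norm_neg, Real.norm_eq_abs, abs_mul, abs_mul, abs_of_pos hx.1,
      abs_of_nonneg (Real.rpow_nonneg hx.1.le h)]
    have h1 := Real.abs_sin_le_one (w * x)
    have h2 := Real.rpow_le_one hx.1.le hx.2 hh.le
    have h3 := Real.rpow_nonneg hx.1.le h
    have h4 : x * |Real.sin (w * x)| ≤ 1 := mul_le_one₀ hx.2 (abs_nonneg _) h1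
    exact mul_le_one₀ h4 h3 h2
  · exact continuous_const.intervalIntegrable _ _
  · refine Eventually.of_forall fun x _ w _ => ?_
    have := ((hasDerivAt_id w).mul_const x).cos.mul_const (x ^ h)
    exact this.congr_deriv (by simp only [id_eq, one_mul]; ring)

/-! ### Double integrals over the unit square -/

lemma intervalIntegral_conj (g : ℝ → ℂ) (a b : ℝ) :
    ∫ x in a..b, conj (g x) = conj (∫ x in a..b, g x) := by
  simp only [intervalIntegral, map_sub, integral_conj]

/-- The weight `1 - z` is the length of the slice `x - y = ±z` of the square, measured along `x`. It
arises by writing the inner integral as `K x - K (x - 1)` and integrating by parts. -/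
lemma integral_integral_sub_eq {k : ℝ → ℂ} (hk : Continuous k) :
    ∫ x in (0 : ℝ)..1, ∫ y in (0 : ℝ)..1, k (x - y) =
      ∫ z in (0 : ℝ)..1, (1 - z : ℝ) * (k z + k (-z)) := by
  set K : ℝ → ℂ := fun x => ∫ z in (0 : ℝ)..x, k z with hK
  have hd : ∀ x, HasDerivAt K (k x) x := fun x =>
    intervalIntegral.integral_hasDerivAt_right (hk.intervalIntegrable _ _)
      (hk.stronglyMeasurableAtFilter _ _) hk.continuousAt
  have hKc : Continuous K := continuous_iff_continuousAt.mpr fun x => (hd x).continuousAt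
  have hK0 : K 0 = 0 := intervalIntegral.integral_same
  have hinner : ∀ x : ℝ, ∫ y in (0 : ℝ)..1, k (x - y) = K x - K (x - 1) := by
    intro x
    rw [intervalIntegral.integral_comp_sub_left, sub_zero, hK]
    exact (intervalIntegral.integral_interval_sub_left (hk.intervalIntegrable _ _)
      (hk.intervalIntegrable _ _)).symm
  -- The primitive `x - 1` of `1` kills the boundary term at `1`; `K 0 = 0` kills the one at `0`.
  have hu : ∀ x : ℝ, HasDerivAt (fun x : ℝ => ((x - 1 : ℝ) : ℂ)) 1 x := fun x => by
    have := ((hasDerivAt_id x).sub_const (1 : ℝ)).ofReal_comp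
    simpa using this
  have h1 : ∫ x in (0 : ℝ)..1, K x = ∫ z in (0 : ℝ)..1, (1 - z : ℝ) * k z := by
    have := intervalIntegral.integral_mul_deriv_eq_deriv_mul (a := 0) (b := 1)
      (u := fun x : ℝ => ((x - 1 : ℝ) : ℂ)) (v := K) (u' := fun _ => 1) (v' := k)
      (fun x _ => hu x) (fun x _ => hd x) (continuous_const.intervalIntegrable _ _)
      (hk.intervalIntegrable _ _)
    simp only [sub_self, Complex.ofReal_zero, zero_mul, hK0, mul_zero, one_mul, zero_sub] at this
    rw [eq_neg_iff_add_eq_zero, add_comm, ← eq_neg_iff_add_eq_zero] at this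
    rw [this, ← intervalIntegral.integral_neg]
    refine intervalIntegral.integral_congr fun x _ => ?_
    push_cast
    ring
  have h2 : ∫ x in (0 : ℝ)..1, K (x - 1) = -∫ z in (0 : ℝ)..1, (1 - z : ℝ) * k (-z) := by
    have e : ∫ x in (0 : ℝ)..1, K (x - 1) = ∫ x in (0 : ℝ)..1, K (-x) := by
      rw [intervalIntegral.integral_comp_sub_right, intervalIntegral.integral_comp_neg]
      norm_num
    have hd' : ∀ x, HasDerivAt (fun x => K (-x)) (-k (-x)) x := fun x => by
      have := (hd (-x)).scomp x (hasDerivAt_neg x)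
      simpa [Function.comp_def] using this
    have := intervalIntegral.integral_mul_deriv_eq_deriv_mul (a := 0) (b := 1)
      (u := fun x : ℝ => ((x - 1 : ℝ) : ℂ)) (v := fun x => K (-x)) (u' := fun _ => 1)
      (v' := fun x => -k (-x)) (fun x _ => hu x) (fun x _ => hd' x)
      (continuous_const.intervalIntegrable _ _)
      (Continuous.intervalIntegrable (by fun_prop) _ _)
    simp only [sub_self, Complex.ofReal_zero, zero_mul, neg_zero, hK0, mul_zero, one_mul,
      zero_sub] at this
    rw [eq_neg_iff_add_eq_zero, add_comm, ← eq_neg_iff_add_eq_zero] at this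
    rw [e, this, ← intervalIntegral.integral_neg, ← intervalIntegral.integral_neg]
    refine intervalIntegral.integral_congr fun x _ => ?_
    push_cast
    ring
  simp only [hinner]
  rw [intervalIntegral.integral_sub (hKc.intervalIntegrable _ _)
    (Continuous.intervalIntegrable (by fun_prop) _ _), h1, h2, sub_neg_eq_add,
    ← intervalIntegral.integral_add (Continuous.intervalIntegrable (by fun_prop) _ _)
    (Continuous.intervalIntegrable (by fun_prop) _ _)]
  refine intervalIntegral.integral_congr fun x _ => ?_
  ring

/-- The function `(r + e sign z)|z|^h`. -/
noncomputable def signedPow (r e h z : ℝ) : ℝ := (r + e) * max z 0 ^ h + (r - e) * max (-z) 0 ^ h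

lemma continuous_signedPow {h : ℝ} (hh : 0 < h) (r e : ℝ) : Continuous (signedPow r e h) := by
  have h1 : Continuous fun x : ℝ => x ^ h := Real.continuous_rpow_const hh.le
  exact (continuous_const.mul (h1.comp (continuous_id.max continuous_const))).add
    (continuous_const.mul (h1.comp (continuous_neg.max continuous_const)))

/-- This separates the covariance into functions of `t`, of `s` and of `t - s`, and shows its
continuity despite `Real.sign`. -/
lemma fbmCov_eq_signedPow {h : ℝ} (hh : 0 < h) (r e t s : ℝ) :
    fbmCov r e h t s = ((r + e) * t ^ h + (r - e) * s ^ h - signedPow r e h (t - s)) / 2 := by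
  unfold fbmCov signedPow
  rcases lt_trichotomy (t - s) 0 with h1 | h1 | h1
  · rw [Real.sign_of_neg h1, abs_of_neg h1, max_eq_right h1.le, max_eq_left (by linarith),
      Real.zero_rpow hh.ne']
    ring
  · rw [h1]
    simp only [abs_zero, neg_zero, max_self, Real.zero_rpow hh.ne']
    ring
  · rw [Real.sign_of_pos h1, abs_of_pos h1, max_eq_left h1.le, max_eq_right (by linarith),
      Real.zero_rpow hh.ne']
    ring

lemma continuous_fbmCov {h : ℝ} (hh : 0 < h) (r e : ℝ) :
    Continuous fun p : ℝ × ℝ => fbmCov r e h p.1 p.2 := by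
  simp only [fbmCov_eq_signedPow hh]
  have h1 : Continuous fun x : ℝ => x ^ h := Real.continuous_rpow_const hh.le
  have h2 := continuous_signedPow hh r e
  fun_prop

lemma fbmCov_mul {T : ℝ} (hT : 0 < T) (r e h : ℝ) {x y : ℝ} (hx : 0 ≤ x) (hy : 0 ≤ y) :
    fbmCov r e h (T * x) (T * y) = T ^ h * fbmCov r e h x y := by
  have hs : Real.sign (T * (x - y)) = Real.sign (x - y) := by
    rw [sign_mul_sign, Real.sign_of_pos hT, one_mul]
  unfold fbmCov
  rw [← mul_sub, hs, abs_mul, abs_of_pos hT, Real.mul_rpow hT.le hx, Real.mul_rpow hT.le hy,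
    Real.mul_rpow hT.le (abs_nonneg _)]
  ring

/-- `∫_0^1 e^{i w x} x^h dx`. -/
noncomputable def expMoment (h w : ℝ) : ℂ :=
  ∫ x in (0 : ℝ)..1, Complex.exp (Complex.I * w * x) * ((x ^ h : ℝ) : ℂ)

lemma exp_I_mul_eq (w x : ℝ) : Complex.exp (Complex.I * w * x) =
    (Real.cos (w * x) : ℂ) + Complex.I * (Real.sin (w * x) : ℂ) := by
  rw [show Complex.I * w * x = ((w * x : ℝ) : ℂ) * Complex.I by push_cast; ring,
    Complex.exp_mul_I, ← Complex.ofReal_cos, ← Complex.ofReal_sin]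
  ring

lemma conj_exp_I_mul (w x : ℝ) : conj (Complex.exp (Complex.I * w * x)) =
    Complex.exp (-(Complex.I * w * x)) := by
  rw [← Complex.exp_conj]
  simp

lemma integral_exp_mul_ofReal {g : ℝ → ℝ} (hg : Continuous g) (w : ℝ) :
    ∫ x in (0 : ℝ)..1, Complex.exp (Complex.I * w * x) * (g x : ℂ) =
      ((∫ x in (0 : ℝ)..1, Real.cos (w * x) * g x : ℝ) : ℂ) +
        Complex.I * ((∫ x in (0 : ℝ)..1, Real.sin (w * x) * g x : ℝ) : ℂ) := by
  rw [← intervalIntegral.integral_ofReal, ← intervalIntegral.integral_ofReal,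
    ← intervalIntegral.integral_const_mul, ← intervalIntegral.integral_add]
  · refine intervalIntegral.integral_congr fun x _ => ?_
    simp only [exp_I_mul_eq]
    push_cast
    ring
  · exact Continuous.intervalIntegrable (by fun_prop) _ _
  · exact Continuous.intervalIntegrable (by fun_prop) _ _

lemma expMoment_eq {h : ℝ} (hh : 0 < h) (w : ℝ) :
    expMoment h w = (cosMoment h w : ℂ) + Complex.I * (sinMoment h w : ℂ) :=
  integral_exp_mul_ofReal (Real.continuous_rpow_const hh.le) w

/-- `∫_0^1 e^{i w x} (1 - x) x^h dx`. -/
noncomputable def expMomentTent (h w : ℝ) : ℂ :=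
  ∫ x in (0 : ℝ)..1, Complex.exp (Complex.I * w * x) * (((1 - x) * x ^ h : ℝ) : ℂ)

/-- The extra factor `x` under the integral is produced by differentiating the sine and cosine
moments in `w`. -/
lemma expMomentTent_eq {h : ℝ} (hh : 0 < h) (w : ℝ) :
    expMomentTent h w = ((cosMoment h w - deriv (sinMoment h) w : ℝ) : ℂ) +
      Complex.I * ((sinMoment h w + deriv (cosMoment h) w : ℝ) : ℂ) := by
  have hc : Continuous fun x : ℝ => x ^ h := Real.continuous_rpow_const hh.le
  rw [expMomentTent, integral_exp_mul_ofReal (by fun_prop) w, (hasDerivAt_sinMoment hh w).deriv,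
    (hasDerivAt_cosMoment hh w).deriv, cosMoment, sinMoment, ← sub_eq_add_neg,
    ← intervalIntegral.integral_sub (Continuous.intervalIntegrable (by fun_prop) _ _)
      (Continuous.intervalIntegrable (by fun_prop) _ _),
    ← intervalIntegral.integral_sub (Continuous.intervalIntegrable (by fun_prop) _ _)
      (Continuous.intervalIntegrable (by fun_prop) _ _)]
  have e : ∀ g : ℝ → ℝ, ∫ x in (0 : ℝ)..1, g x * ((1 - x) * x ^ h) =
      ∫ x in (0 : ℝ)..1, (g x * x ^ h - x * g x * x ^ h) := fun g =>
    intervalIntegral.integral_congr fun x _ => by ring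
  rw [e fun x => Real.cos (w * x), e fun x => Real.sin (w * x)]

lemma integral_exp_neg (w : ℝ) :
    ∫ y in (0 : ℝ)..1, Complex.exp (-(Complex.I * w * y)) =
      (Real.sinc w : ℂ) - Complex.I * (((1 - Real.cos w) / w : ℝ) : ℂ) := by
  -- At `w = 0` the convention `0 / 0 = 0` agrees with the limit of `(1 - cos w) / w`.
  rcases eq_or_ne w 0 with rfl | hw
  · simp
  · have hc : -(Complex.I * w) ≠ 0 := by simp [hw]
    have e : ∀ y : ℝ, -(Complex.I * w * y) = -(Complex.I * w) * y := fun y => by ring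
    simp only [e]
    rw [integral_exp_mul_complex hc, Real.sinc_of_ne_zero hw]
    have hw' : (w : ℂ) ≠ 0 := by exact_mod_cast hw
    have e2 : Complex.exp (-(Complex.I * w) * (1 : ℝ)) =
        (Real.cos w : ℂ) - Complex.I * (Real.sin w : ℂ) := by
      have := exp_I_mul_eq (-w) 1
      rw [mul_one, Real.cos_neg, Real.sin_neg] at this
      rw [show -(Complex.I * (w : ℂ)) * ((1 : ℝ) : ℂ) = Complex.I * ((-w : ℝ) : ℂ) * ((1 : ℝ) : ℂ) by
        push_cast; ring, this]
      push_cast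
      ring
    rw [e2]
    push_cast
    rw [mul_zero, Complex.exp_zero]
    have hI := Complex.I_ne_zero
    field_simp
    linear_combination (1 - Complex.cos w) * Complex.I_sq

/-- The Fourier integral of the covariance function over the unit square. -/
lemma integral_integral_exp_mul_fbmCov {h : ℝ} (hh : 0 < h) (r e w : ℝ) :
    ∫ x in (0 : ℝ)..1, ∫ y in (0 : ℝ)..1, Complex.exp (Complex.I * w * (x - y)) *
        (fbmCov r e h x y : ℂ) =
      ((r * rhoBracket h w : ℝ) : ℂ) + Complex.I * ((e * etaBracket h w : ℝ) : ℂ) := by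
  have hc : Continuous fun x : ℝ => x ^ h := Real.continuous_rpow_const hh.le
  have hs := continuous_signedPow hh r e
  set N : ℂ := ∫ y in (0 : ℝ)..1, Complex.exp (-(Complex.I * w * y)) with hN
  set k : ℝ → ℂ := fun z => Complex.exp (Complex.I * w * z) * (signedPow r e h z : ℂ) with hk
  have hkc : Continuous k := by fun_prop
  have hNc : ∫ x in (0 : ℝ)..1, Complex.exp (Complex.I * w * x) = conj N := by
    rw [hN, ← intervalIntegral_conj]
    refine intervalIntegral.integral_congr fun x _ => ?_
    simp only [← conj_exp_I_mul, Complex.conj_conj]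
  have hMc : ∫ y in (0 : ℝ)..1, Complex.exp (-(Complex.I * w * y)) * ((y ^ h : ℝ) : ℂ) =
      conj (expMoment h w) := by
    rw [expMoment, ← intervalIntegral_conj]
    refine intervalIntegral.integral_congr fun x _ => ?_
    simp only [map_mul, conj_exp_I_mul, Complex.conj_ofReal]
  have hsplit : ∀ x y : ℝ, Complex.exp (Complex.I * w * (x - y)) * (fbmCov r e h x y : ℂ) =
      ((r + e) / 2 : ℂ) * (Complex.exp (Complex.I * w * x) * ((x ^ h : ℝ) : ℂ)) *
        Complex.exp (-(Complex.I * w * y)) +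
      ((r - e) / 2 : ℂ) * Complex.exp (Complex.I * w * x) *
        (Complex.exp (-(Complex.I * w * y)) * ((y ^ h : ℝ) : ℂ)) - (1 / 2 : ℂ) * k (x - y) := by
    intro x y
    have e1 : Complex.exp (Complex.I * w * (x - y)) =
        Complex.exp (Complex.I * w * x) * Complex.exp (-(Complex.I * w * y)) := by
      rw [← Complex.exp_add]
      ring_nf
    simp only [hk]
    rw [fbmCov_eq_signedPow hh, Complex.ofReal_sub, e1]
    push_cast
    ring
  have hinner : ∀ x : ℝ, ∫ y in (0 : ℝ)..1, Complex.exp (Complex.I * w * (x - y)) *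
      (fbmCov r e h x y : ℂ) =
      ((r + e) / 2 : ℂ) * N * (Complex.exp (Complex.I * w * x) * ((x ^ h : ℝ) : ℂ)) +
      ((r - e) / 2 : ℂ) * conj (expMoment h w) * Complex.exp (Complex.I * w * x) -
      (1 / 2 : ℂ) * ∫ y in (0 : ℝ)..1, k (x - y) := by
    intro x
    simp only [hsplit]
    rw [intervalIntegral.integral_sub (Continuous.intervalIntegrable (by fun_prop) _ _)
      (Continuous.intervalIntegrable (by fun_prop) _ _),
      intervalIntegral.integral_add (Continuous.intervalIntegrable (by fun_prop) _ _)
      (Continuous.intervalIntegrable (by fun_prop) _ _), intervalIntegral.integral_const_mul,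
      intervalIntegral.integral_const_mul, intervalIntegral.integral_const_mul, hMc, ← hN]
    ring
  have hkk : Continuous fun x : ℝ => ∫ y in (0 : ℝ)..1, k (x - y) :=
    intervalIntegral.continuous_parametric_intervalIntegral_of_continuous' (by fun_prop) _ _
  have hQ : ∫ z in (0 : ℝ)..1, ((1 - z : ℝ) : ℂ) * (k z + k (-z)) =
      (r + e : ℂ) * expMomentTent h w + (r - e : ℂ) * conj (expMomentTent h w) := by
    rw [expMomentTent, ← intervalIntegral_conj, ← intervalIntegral.integral_const_mul,
      ← intervalIntegral.integral_const_mul, ← intervalIntegral.integral_add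
      (Continuous.intervalIntegrable (by fun_prop) _ _)
      (Continuous.intervalIntegrable (by fun_prop) _ _)]
    refine intervalIntegral.integral_congr fun z hz => ?_
    rw [Set.uIcc_of_le zero_le_one] at hz
    have s1 : signedPow r e h z = (r + e) * z ^ h := by
      rw [signedPow, max_eq_left hz.1, max_eq_right (by linarith [hz.1]), Real.zero_rpow hh.ne']
      ring
    have s2 : signedPow r e h (-z) = (r - e) * z ^ h := by
      rw [signedPow, neg_neg, max_eq_left hz.1, max_eq_right (by linarith [hz.1]),
        Real.zero_rpow hh.ne']
      ring
    simp only [hk, s1, s2, map_mul, conj_exp_I_mul, Complex.conj_ofReal]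
    push_cast
    rw [mul_neg]
    ring
  simp only [hinner]
  -- With `M = expMoment h w` and `Q = expMomentTent h w`, the total is the half-sum of `(r + e)(N M
  -- - Q)` and `(r - e)` times its conjugate, that is `r Re(N M - Q) + i e Im(N M - Q)`. The
  -- brackets are this real and this imaginary part.
  rw [intervalIntegral.integral_sub (Continuous.intervalIntegrable (by fun_prop) _ _)
      (Continuous.intervalIntegrable (by fun_prop) _ _),
      intervalIntegral.integral_add (Continuous.intervalIntegrable (by fun_prop) _ _)
      (Continuous.intervalIntegrable (by fun_prop) _ _), intervalIntegral.integral_const_mul,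
      intervalIntegral.integral_const_mul, intervalIntegral.integral_const_mul,
      integral_integral_sub_eq hkc, hQ, hNc, ← expMoment, hN, integral_exp_neg, expMoment_eq hh,
      expMomentTent_eq hh, rhoBracket, etaBracket]
  simp only [map_add, map_sub, map_mul, Complex.conj_ofReal, Complex.conj_I]
  push_cast
  ring_nf
  simp only [Complex.I_sq]
  ring

/-- Each integration contributes `T`, self-similarity contributes `T ^ h`, and the prefactor removes
one `T`. -/
lemma integral_integral_exp_mul_fbmCov_scaled {h T : ℝ} (hh : 0 < h) (hT : 0 < T) (r e f : ℝ) :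
    (1 / (T : ℂ)) * ∫ t in (0 : ℝ)..T, ∫ s in (0 : ℝ)..T, Complex.exp (Complex.I * f * (t - s)) *
        (fbmCov r e h t s : ℂ) =
      ((T ^ (h + 1) : ℝ) : ℂ) * (((r * rhoBracket h (f * T) : ℝ) : ℂ) +
        Complex.I * ((e * etaBracket h (f * T) : ℝ) : ℂ)) := by
  have scale : ∀ g : ℝ → ℂ, ∫ t in (0 : ℝ)..T, g t = (T : ℂ) * ∫ x in (0 : ℝ)..1, g (T * x) := by
    intro g
    have := intervalIntegral.smul_integral_comp_mul_left (a := 0) (b := 1) g T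
    rw [mul_zero, mul_one] at this
    rw [← this, Complex.real_smul]
  rw [← integral_integral_exp_mul_fbmCov hh, scale]
  have e1 : ∀ x ∈ Set.uIcc (0 : ℝ) 1, ∫ s in (0 : ℝ)..T,
      Complex.exp (Complex.I * f * ((T * x : ℝ) - s)) * (fbmCov r e h (T * x) s : ℂ) =
      (T * (T ^ h : ℝ) : ℂ) * ∫ y in (0 : ℝ)..1, Complex.exp (Complex.I * (f * T : ℝ) * (x - y)) *
        (fbmCov r e h x y : ℂ) := by
    intro x hx
    rw [Set.uIcc_of_le zero_le_one] at hx
    rw [scale, mul_assoc, ← intervalIntegral.integral_const_mul ((T ^ h : ℝ) : ℂ)]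
    congr 1
    refine intervalIntegral.integral_congr fun y hy => ?_
    rw [Set.uIcc_of_le zero_le_one] at hy
    rw [fbmCov_mul hT r e h hx.1 hy.1]
    push_cast
    rw [show Complex.I * f * (T * x - T * y) = Complex.I * (f * T) * (x - y) by ring]
    ring
  rw [intervalIntegral.integral_congr e1, intervalIntegral.integral_const_mul,
    Real.rpow_add_one hT.ne']
  have hT' : (T : ℂ) ≠ 0 := by exact_mod_cast hT.ne'
  push_cast
  field_simp

/-! ### Jointly measurable processes with bounded second moments -/

section SecondMoments

variable {Ω : Type*} [MeasurableSpace Ω] {P : Measure Ω} [IsProbabilityMeasure P]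
  {μ : Measure ℝ} [IsFiniteMeasure μ] {X Y : ℝ → Ω → ℝ} {C D : ℝ}

lemma integrable_of_second_moment_le
    (hX : AEStronglyMeasurable (fun p : ℝ × Ω => X p.1 p.2) (μ.prod P))
    (h : ∀ᵐ t ∂μ, MemLp (X t) 2 P ∧ ∫ ω, X t ω * X t ω ∂P ≤ C) :
    Integrable (fun p : ℝ × Ω => X p.1 p.2) (μ.prod P) := by
  rw [integrable_prod_iff hX]
  refine ⟨h.mono fun t ht => ht.1.integrable one_le_two, ?_⟩
  refine (integrable_const (1 + C)).mono' hX.norm.integral_prod_right' ?_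
  filter_upwards [h] with t ht
  have i1 : Integrable (fun ω => X t ω * X t ω) P := ht.1.integrable_mul ht.1
  have i2 := ht.1.integrable one_le_two
  rw [Real.norm_of_nonneg (integral_nonneg fun ω => norm_nonneg _)]
  calc ∫ ω, ‖X t ω‖ ∂P ≤ ∫ ω, (1 + X t ω * X t ω) ∂P := by
        refine integral_mono i2.norm ((integrable_const 1).add i1) fun ω => ?_
        simp only [Real.norm_eq_abs]
        nlinarith [abs_mul_abs_self (X t ω), sq_nonneg (|X t ω| - 1), abs_nonneg (X t ω)]
    _ = 1 + ∫ ω, X t ω * X t ω ∂P := by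
        rw [integral_add (integrable_const 1) i1]
        simp
    _ ≤ 1 + C := by linarith [ht.2]

/-- The bound `|X Y| ≤ X² + Y²` controls the expectation uniformly in both times, and the time
measure is finite. -/
lemma integrable_mul_of_second_moment_le
    (hX : AEStronglyMeasurable (fun p : ℝ × Ω => X p.1 p.2) (μ.prod P))
    (hY : AEStronglyMeasurable (fun p : ℝ × Ω => Y p.1 p.2) (μ.prod P))
    (h : ∀ᵐ t ∂μ, MemLp (X t) 2 P ∧ ∫ ω, X t ω * X t ω ∂P ≤ C)
    (h' : ∀ᵐ t ∂μ, MemLp (Y t) 2 P ∧ ∫ ω, Y t ω * Y t ω ∂P ≤ D) :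
    Integrable (fun p : (ℝ × ℝ) × Ω => X p.1.1 p.2 * Y p.1.2 p.2) ((μ.prod μ).prod P) := by
  have q1 : Measure.QuasiMeasurePreserving (Prod.map Prod.fst id) ((μ.prod μ).prod P)
      (μ.prod P) :=
    QuasiMeasurePreserving.prodMap Measure.quasiMeasurePreserving_fst
      (Measure.QuasiMeasurePreserving.id P)
  have q2 : Measure.QuasiMeasurePreserving (Prod.map Prod.snd id) ((μ.prod μ).prod P)
      (μ.prod P) :=
    QuasiMeasurePreserving.prodMap Measure.quasiMeasurePreserving_snd
      (Measure.QuasiMeasurePreserving.id P)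
  have hXY : AEStronglyMeasurable (fun p : (ℝ × ℝ) × Ω => X p.1.1 p.2 * Y p.1.2 p.2)
      ((μ.prod μ).prod P) :=
    (hX.comp_quasiMeasurePreserving q1).mul (hY.comp_quasiMeasurePreserving q2)
  have hboth : ∀ᵐ p ∂μ.prod μ, (MemLp (X p.1) 2 P ∧ ∫ ω, X p.1 ω * X p.1 ω ∂P ≤ C) ∧
      (MemLp (Y p.2) 2 P ∧ ∫ ω, Y p.2 ω * Y p.2 ω ∂P ≤ D) :=
    (Measure.quasiMeasurePreserving_fst.ae h).and (Measure.quasiMeasurePreserving_snd.ae h')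
  rw [integrable_prod_iff hXY]
  refine ⟨hboth.mono fun p hp => hp.1.1.integrable_mul hp.2.1, ?_⟩
  refine (integrable_const (C + D)).mono' hXY.norm.integral_prod_right' ?_
  filter_upwards [hboth] with p hp
  obtain ⟨⟨m1, c1⟩, m2, c2⟩ := hp
  have i1 : Integrable (fun ω => X p.1 ω * X p.1 ω) P := m1.integrable_mul m1
  have i2 : Integrable (fun ω => Y p.2 ω * Y p.2 ω) P := m2.integrable_mul m2
  have i3 : Integrable (fun ω => X p.1 ω * Y p.2 ω) P := m1.integrable_mul m2
  rw [Real.norm_of_nonneg (integral_nonneg fun ω => norm_nonneg _)]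
  calc ∫ ω, ‖X p.1 ω * Y p.2 ω‖ ∂P ≤ ∫ ω, (X p.1 ω * X p.1 ω + Y p.2 ω * Y p.2 ω) ∂P := by
        refine integral_mono i3.norm (i1.add i2) fun ω => ?_
        simp only [Real.norm_eq_abs, abs_mul]
        nlinarith [abs_mul_abs_self (X p.1 ω), abs_mul_abs_self (Y p.2 ω),
          sq_nonneg (|X p.1 ω| - |Y p.2 ω|), mul_nonneg (abs_nonneg (X p.1 ω)) (abs_nonneg (Y p.2 ω))]
    _ = ∫ ω, X p.1 ω * X p.1 ω ∂P + ∫ ω, Y p.2 ω * Y p.2 ω ∂P := integral_add i1 i2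
    _ ≤ C + D := by linarith

end SecondMoments

/-! ### Power spectral densities -/

section PowerSpectralDensity

variable {Ω : Type*} {T : ℝ}

/-- `integral_prod_mul` needs no integrability, so the identity holds for every `ω`, including
exceptional trajectories. -/
lemma psd_eq_integral_prod (hT : 0 ≤ T) (Z : Fin 2 → ℝ → Ω → ℝ) (j k : Fin 2) (f : ℝ) (ω : Ω) :
    psd Z j k f T ω = (1 / (T : ℂ)) * ∫ p : ℝ × ℝ,
      Complex.exp (Complex.I * f * (p.1 - p.2)) * ((Z j p.1 ω * Z k p.2 ω : ℝ) : ℂ)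
      ∂((volume.restrict (Set.Ioc 0 T)).prod (volume.restrict (Set.Ioc 0 T))) := by
  rw [psd, intervalIntegral.integral_of_le hT, intervalIntegral.integral_of_le hT,
    ← integral_conj, ← integral_prod_mul]
  congr 1
  refine integral_congr_ae (Eventually.of_forall fun p => ?_)
  simp only [map_mul, Complex.conj_ofReal, conj_exp_I_mul]
  rw [show Complex.I * (f : ℂ) * ((p.1 : ℂ) - p.2) = Complex.I * f * p.1 + -(Complex.I * f * p.2) by
    ring, Complex.exp_add]
  push_cast
  ring

lemma norm_exp_I_mul_sub (f t s : ℝ) : ‖Complex.exp (Complex.I * f * (t - s))‖ = 1 := by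
  rw [Complex.norm_exp]
  simp

variable [MeasurableSpace Ω] {P : Measure Ω} [IsProbabilityMeasure P] {Z : Fin 2 → ℝ → Ω → ℝ}

/-- The ensemble average of the trajectory-wise power spectral density. -/
lemma integral_psd_eq_ensemblePSD (hT : 0 ≤ T) (j k : Fin 2) (f : ℝ)
    (hint : Integrable (fun p : (ℝ × ℝ) × Ω => Z j p.1.1 p.2 * Z k p.1.2 p.2)
      (((volume.restrict (Set.Ioc 0 T)).prod (volume.restrict (Set.Ioc 0 T))).prod P)) :
    Integrable (psd Z j k f T) P ∧ ∫ ω, psd Z j k f T ω ∂P = ensemblePSD Z P j k f T := by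
  set μ := volume.restrict (Set.Ioc (0 : ℝ) T) with hμ
  have hE : Integrable (fun p : (ℝ × ℝ) × Ω => Complex.exp (Complex.I * f * (p.1.1 - p.1.2)) *
      ((Z j p.1.1 p.2 * Z k p.1.2 p.2 : ℝ) : ℂ)) ((μ.prod μ).prod P) := by
    have hR : Integrable (fun p : (ℝ × ℝ) × Ω => ((Z j p.1.1 p.2 * Z k p.1.2 p.2 : ℝ) : ℂ))
        ((μ.prod μ).prod P) := hint.ofReal
    have hc : Measurable fun p : (ℝ × ℝ) × Ω =>
        Complex.exp (Complex.I * f * ((p.1.1 : ℂ) - p.1.2)) := by fun_prop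
    refine hR.mono (hc.aestronglyMeasurable.mul hR.1) (Eventually.of_forall fun p => ?_)
    rw [norm_mul, norm_exp_I_mul_sub, one_mul]
  have hpsd : psd Z j k f T = fun ω => (1 / (T : ℂ)) * ∫ p : ℝ × ℝ,
      Complex.exp (Complex.I * f * (p.1 - p.2)) * ((Z j p.1 ω * Z k p.2 ω : ℝ) : ℂ)
      ∂(μ.prod μ) := funext fun ω => psd_eq_integral_prod hT Z j k f ω
  have hpsdI : ∀ t s, psdIntegrand Z P j k f t s = ∫ ω,
      Complex.exp (Complex.I * f * (t - s)) * ((Z j t ω * Z k s ω : ℝ) : ℂ) ∂P := by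
    intro t s
    rw [psdIntegrand, integral_const_mul]
    congr 1
    exact integral_ofReal.symm
  refine ⟨hpsd ▸ hE.integral_prod_right.const_mul _, ?_⟩
  -- Fubini moves the expectation inside the double time integral and then iterates the latter.
  rw [hpsd, integral_const_mul, ← integral_prod_symm _ hE, integral_prod _ hE,
    integral_prod _ hE.integral_prod_left, ensemblePSD, intervalIntegral.integral_of_le hT]
  simp only [intervalIntegral.integral_of_le hT, hpsdI, ← hμ]

end PowerSpectralDensity

end FBm2D

/-! ### The main theorem -/

open FBm2D
theorem theorem4 {Ω : Type*} [MeasurableSpace Ω] (P : Measure Ω) [IsProbabilityMeasure P]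
    (m : Model) (H σ : Fin 2 → ℝ) (ρ : ℝ)
    (hH : ∀ i, 0 < H i ∧ H i < 1) (hσ : ∀ i, 0 < σ i) (hρ : |ρ| ≤ 1)
    (hsum : H 0 + H 1 ≠ 1)
    (hwb : m = Model.wellBalanced → ∀ i, H i ≠ 1 / 2)
    (Z : Fin 2 → ℝ → Ω → ℝ) (hZ : IsFBm2D m H σ ρ Z P)
    (T : ℝ) (hT : 0 < T) (f : ℝ) (j k : Fin 2) :
    -- the derivatives that occur in the formula exist
    DifferentiableAt ℝ (cosMoment (H j + H k)) (f * T) ∧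
    DifferentiableAt ℝ (sinMoment (H j + H k)) (f * T) ∧
    -- the ensemble-averaged density is well defined and has the closed form
    (∀ t s : ℝ, 0 ≤ t → 0 ≤ s → Integrable (fun ω => Z j t ω * Z k s ω) P) ∧
    IntegrableOn (fun p : ℝ × ℝ => psdIntegrand Z P j k f p.1 p.2)
      (Set.Icc 0 T ×ˢ Set.Icc 0 T) ∧
    ensemblePSD Z P j k f T = closedForm m H σ ρ j k (f * T) T ∧
    -- for a jointly measurable version of the process it is the expected value of the
    -- density of a trajectory
    ((∀ i, AEStronglyMeasurable (fun p : ℝ × Ω => Z i p.1 p.2)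
        ((volume.restrict (Set.Icc 0 T)).prod P)) →
      (∀ᵐ ω ∂P, ∀ i, IntervalIntegrable (fun t => Z i t ω) volume 0 T) ∧
      Integrable (psd Z j k f T) P ∧
      ∫ ω, psd Z j k f T ω ∂P = closedForm m H σ ρ j k (f * T) T) := by
  have hh : ∀ i l, 0 < H i + H l := fun i l => add_pos (hH i).1 (hH l).1
  have hcov := fun (i l : Fin 2) (t s : ℝ) (ht : 0 ≤ t) (hs : 0 ≤ s) =>
    hZ.integral_mul hH hρ hsum hwb i l ht hs
  -- The process is constrained only at nonnegative times, so the integrand is replaced by the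
  -- explicit continuous function only there.
  have hval : ∀ t s : ℝ, 0 ≤ t → 0 ≤ s → psdIntegrand Z P j k f t s =
      ((σ j * σ k : ℝ) : ℂ) * (Complex.exp (Complex.I * f * (t - s)) *
        (fbmCov (rhoParam m H ρ j k) (etaParam m H ρ j k) (H j + H k) t s : ℂ)) := by
    intro t s ht hs
    rw [psdIntegrand, hcov j k t s ht hs]
    push_cast
    ring
  have hclosed : ensemblePSD Z P j k f T = closedForm m H σ ρ j k (f * T) T := by
    have e : ∫ t in (0 : ℝ)..T, ∫ s in (0 : ℝ)..T, psdIntegrand Z P j k f t s =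
        ((σ j * σ k : ℝ) : ℂ) * ∫ t in (0 : ℝ)..T, ∫ s in (0 : ℝ)..T,
          Complex.exp (Complex.I * f * (t - s)) *
          (fbmCov (rhoParam m H ρ j k) (etaParam m H ρ j k) (H j + H k) t s : ℂ) := by
      rw [← intervalIntegral.integral_const_mul]
      refine intervalIntegral.integral_congr fun t ht => ?_
      rw [Set.uIcc_of_le hT.le] at ht
      rw [← intervalIntegral.integral_const_mul]
      refine intervalIntegral.integral_congr fun s hs => ?_
      rw [Set.uIcc_of_le hT.le] at hs
      exact hval t s ht.1 hs.1
    rw [ensemblePSD, e, mul_left_comm, integral_integral_exp_mul_fbmCov_scaled (hh j k) hT,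
      closedForm]
    push_cast
    ring
  refine ⟨(hasDerivAt_cosMoment (hh j k) _).differentiableAt,
    (hasDerivAt_sinMoment (hh j k) _).differentiableAt,
    fun t s ht hs => (hZ.memLp ht j).integrable_mul (hZ.memLp hs k), ?_, hclosed, fun hmeas => ?_⟩
  · have hc := continuous_fbmCov (hh j k) (rhoParam m H ρ j k) (etaParam m H ρ j k)
    refine (integrableOn_congr_fun (fun p hp => (hval p.1 p.2 hp.1.1 hp.2.1).symm)
      (measurableSet_Icc.prod measurableSet_Icc)).mp ?_
    exact ContinuousOn.integrableOn_compact (isCompact_Icc.prod isCompact_Icc)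
      (Continuous.continuousOn (by fun_prop))
  -- On the diagonal the covariance is `σ_i² t ^ (2 H_i)`, which is largest at `t = T`.
  · have hsecond : ∀ i, ∀ᵐ t ∂volume.restrict (Set.Ioc 0 T), MemLp (Z i t) 2 P ∧
        ∫ ω, Z i t ω * Z i t ω ∂P ≤ σ i * σ i * T ^ (H i + H i) := by
      intro i
      refine (ae_restrict_iff' measurableSet_Ioc).mpr (Eventually.of_forall fun t ht => ?_)
      refine ⟨hZ.memLp ht.1.le i, ?_⟩
      have e : fbmCov (rhoParam m H ρ i i) (etaParam m H ρ i i) (H i + H i) t t =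
          t ^ (H i + H i) := by
        simp [fbmCov, rhoParam, etaParam, Real.zero_rpow (hh i i).ne']
      rw [hcov i i t t ht.1.le ht.1.le, e]
      exact mul_le_mul_of_nonneg_left (Real.rpow_le_rpow ht.1.le ht.2 (hh i i).le)
        (mul_self_nonneg _)
    have hmeas' : ∀ i, AEStronglyMeasurable (fun p : ℝ × Ω => Z i p.1 p.2)
        ((volume.restrict (Set.Ioc 0 T)).prod P) := fun i => by
      rw [Measure.restrict_congr_set Ioc_ae_eq_Icc]
      exact hmeas i
    have hpsd := integral_psd_eq_ensemblePSD hT.le j k f (integrable_mul_of_second_moment_le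
      (hmeas' j) (hmeas' k) (hsecond j) (hsecond k))
    refine ⟨ae_all_iff.mpr fun i => ?_, hpsd.1, hpsd.2.trans hclosed⟩
    filter_upwards [(integrable_of_second_moment_le (hmeas' i) (hsecond i)).prod_left_ae]
      with ω hω
    exact (intervalIntegrable_iff_integrableOn_Ioc_of_le hT.le).mpr hω
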